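/- Let $\varepsilon>0$, $y_0\in(-1,0]$, $c_2>0$, and put $$\varepsilon_1=\frac{\varepsilon}{(1+y_0)^2},\qquad \varepsilon_2=\frac{\varepsilon}{(1-y_0)^2},\qquad a=\frac{1+y_0}{1-y_0},\qquad \mathcal T=\{(x,y)\in\mathbb R^2 : 0\le y\le x\le 1\}.$$ Let $\lambda_1,\lambda_2\in C^1([0,1])$. Let $k_{11}\in C^1(\mathcal T)$, and let $k_{12}\in C(\mathcal T)$ be such that its restrictions to $\{(x,y)\in\mathcal T:\sqrt{\varepsilon_1}\,y\le\sqrt{\varepsilon_2}\,x\}$ and to $\{(x,y)\in\mathcal T:\sqrt{\varepsilon_1}\,y\ge\sqrt{\varepsilon_2}\,x\}$ are of class $C^1$ (for instance, $k_{11},k_{12}\in C^2(\mathcal T)$). For functions $\hat k_{21},\hat k_{22},\check k_{21},\check k_{22}$ on $\mathcal T$ write $$k_{21}(x,y)=\frac1{2\sqrt{\varepsilon_2}}\int_y^x\bigl(\check k_{21}(z,y)+\hat k_{21}(z,y)\bigr)dz,$$ $$k_{22}(x,y)=-\int_0^y\frac{\lambda_2(z)+c_2}{2\varepsilon_2}\,dz+\frac1{2\sqrt{\varepsilon_2}}\int_y^x\bigl(\check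 k_{22}(z,y)+\hat k_{22}(z,y)\bigr)dz,$$ $$g[k_{21}](x)=\frac{\varepsilon_2-\varepsilon_1}{2\sqrt{\varepsilon_1}}\bigl(\check k_{21}(x,x)-\hat k_{21}(x,x)\bigr).$$ Consider the system, for $(x,y)\in\mathcal T$ and $i=1,2$, $$\sqrt{\varepsilon_2}\,\partial_x\hat k_{2i}+\sqrt{\varepsilon_i}\,\partial_y\hat k_{2i}=(\lambda_i(y)+c_2)\,k_{2i}-g[k_{21}](x)\,k_{1i},$$ $$\sqrt{\varepsilon_2}\,\partial_x\check k_{2i}-\sqrt{\varepsilon_i}\,\partial_y\check k_{2i}=(\lambda_i(y)+c_2)\,k_{2i}-g[k_{21}](x)\,k_{1i},$$ with the boundary conditions, for $x\in[0,1]$, $$\hat k_{21}(x,0)=-\frac{1-a^2}{1+a^2}\check k_{21}(x,0)+\frac{2a^3}{1+a^2}\check k_{22}(x,0),\qquad \hat k_{22}(x,0)=\frac{2}{a(1+a^2)}\check k_{21}(x,0)+\frac{1-a^2}{1+a^2}\check k_{22}(x,0),$$ $$\check k_{21}(x,x)=-\frac{\sqrt{\varepsilon_1}-\sqrt{\varepsilon_2}}{\sqrt{\varepsilon_1}+\sqrt{\varepsilon_2}}\,\hat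 k_{21}(x,x),\qquad \check k_{22}(x,x)=-\frac{\lambda_2(x)+c_2}{2\sqrt{\varepsilon_2}}.$$ This system has exactly one solution $(\hat k_{21},\hat k_{22},\check k_{21},\check k_{22})$ with all four components in $C^1(\mathcal T)$. For this solution, $k_{21},k_{22}\in C^2(\mathcal T)$, and on $\mathcal T$, for $i=1,2$, $$\hat k_{2i}=\sqrt{\varepsilon_2}\,\partial_xk_{2i}-\sqrt{\varepsilon_i}\,\partial_yk_{2i},\qquad \check k_{2i}=\sqrt{\varepsilon_2}\,\partial_xk_{2i}+\sqrt{\varepsilon_i}\,\partial_yk_{2i}.$$ -/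

import Mathlib

open Set

noncomputable section

namespace FoldedKernel

/-- Diffusion coefficient of the first folded state. -/
def eps1 (ε y₀ : ℝ) : ℝ := ε / (1 + y₀) ^ 2

/-- Diffusion coefficient of the second folded state. -/
def eps2 (ε y₀ : ℝ) : ℝ := ε / (1 - y₀) ^ 2

/-- The folding ratio. -/
def foldRatio (y₀ : ℝ) : ℝ := (1 + y₀) / (1 - y₀)

/-- The closed triangle `0 ≤ y ≤ x ≤ 1`; points are written `(x, y)`. -/
def triangle : Set (ℝ × ℝ) := {p | 0 ≤ p.2 ∧ p.2 ≤ p.1 ∧ p.1 ≤ 1}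

/-- The part of the triangle on or below the ray `√ε₁ y = √ε₂ x`. -/
def lowerPart (ε y₀ : ℝ) : Set (ℝ × ℝ) :=
  {p ∈ triangle | √(eps1 ε y₀) * p.2 ≤ √(eps2 ε y₀) * p.1}

/-- The part of the triangle on or above the ray `√ε₁ y = √ε₂ x`. -/
def upperPart (ε y₀ : ℝ) : Set (ℝ × ℝ) :=
  {p ∈ triangle | √(eps2 ε y₀) * p.1 ≤ √(eps1 ε y₀) * p.2}

/-- `∂ₓ f` on the closed triangle (one-sided on its boundary). -/
def dx (f : ℝ × ℝ → ℝ) (p : ℝ × ℝ) : ℝ := fderivWithin ℝ f triangle p (1, 0)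

/-- `∂_y f` on the closed triangle (one-sided on its boundary). -/
def dy (f : ℝ × ℝ → ℝ) (p : ℝ × ℝ) : ℝ := fderivWithin ℝ f triangle p (0, 1)

/-- The kernel `k₂₁` recovered from its Riemann invariants
`kh = √ε₂ ∂ₓ k₂₁ - √ε₁ ∂_y k₂₁` and `kc = √ε₂ ∂ₓ k₂₁ + √ε₁ ∂_y k₂₁`. -/
def k21Of (ε y₀ : ℝ) (kh kc : ℝ × ℝ → ℝ) (p : ℝ × ℝ) : ℝ :=
  1 / (2 * √(eps2 ε y₀)) * ∫ z in p.2..p.1, (kc (z, p.2) + kh (z, p.2))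

/-- The kernel `k₂₂` recovered from its Riemann invariants
`kh = √ε₂ ∂ₓ k₂₂ - √ε₂ ∂_y k₂₂` and `kc = √ε₂ ∂ₓ k₂₂ + √ε₂ ∂_y k₂₂`. -/
def k22Of (ε y₀ c₂ : ℝ) (lam₂ : ℝ → ℝ) (kh kc : ℝ × ℝ → ℝ) (p : ℝ × ℝ) : ℝ :=
  -(∫ z in (0 : ℝ)..p.2, (lam₂ z + c₂) / (2 * eps2 ε y₀)) +
    1 / (2 * √(eps2 ε y₀)) * ∫ z in p.2..p.1, (kc (z, p.2) + kh (z, p.2))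

/-- The trace coupling `g[k₂₁](x) = (ε₂ - ε₁) ∂_y k₂₁(x, x)` in terms of the Riemann invariants
of `k₂₁`. -/
def gTrace (ε y₀ : ℝ) (kh kc : ℝ × ℝ → ℝ) (x : ℝ) : ℝ :=
  (eps2 ε y₀ - eps1 ε y₀) / (2 * √(eps1 ε y₀)) * (kc (x, x) - kh (x, x))

/-- `(kh₂₁, kh₂₂, kc₂₁, kc₂₂)` is a `C¹` solution, on the closed triangle, of the second-row
kernel system with sources `k₁₁`, `k₁₂`. -/
structure IsSecondRowSolution (ε y₀ c₂ : ℝ) (lam₁ lam₂ : ℝ → ℝ) (k₁₁ k₁₂ : ℝ × ℝ → ℝ)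
    (kh₂₁ kh₂₂ kc₂₁ kc₂₂ : ℝ × ℝ → ℝ) : Prop where
  contDiff_kh₂₁ : ContDiffOn ℝ 1 kh₂₁ triangle
  contDiff_kh₂₂ : ContDiffOn ℝ 1 kh₂₂ triangle
  contDiff_kc₂₁ : ContDiffOn ℝ 1 kc₂₁ triangle
  contDiff_kc₂₂ : ContDiffOn ℝ 1 kc₂₂ triangle
  pde_kh₂₁ : ∀ p ∈ triangle,
    √(eps2 ε y₀) * dx kh₂₁ p + √(eps1 ε y₀) * dy kh₂₁ p =
      (lam₁ p.2 + c₂) * k21Of ε y₀ kh₂₁ kc₂₁ p - gTrace ε y₀ kh₂₁ kc₂₁ p.1 * k₁₁ p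
  pde_kh₂₂ : ∀ p ∈ triangle,
    √(eps2 ε y₀) * dx kh₂₂ p + √(eps2 ε y₀) * dy kh₂₂ p =
      (lam₂ p.2 + c₂) * k22Of ε y₀ c₂ lam₂ kh₂₂ kc₂₂ p - gTrace ε y₀ kh₂₁ kc₂₁ p.1 * k₁₂ p
  pde_kc₂₁ : ∀ p ∈ triangle,
    √(eps2 ε y₀) * dx kc₂₁ p - √(eps1 ε y₀) * dy kc₂₁ p =
      (lam₁ p.2 + c₂) * k21Of ε y₀ kh₂₁ kc₂₁ p - gTrace ε y₀ kh₂₁ kc₂₁ p.1 * k₁₁ p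
  pde_kc₂₂ : ∀ p ∈ triangle,
    √(eps2 ε y₀) * dx kc₂₂ p - √(eps2 ε y₀) * dy kc₂₂ p =
      (lam₂ p.2 + c₂) * k22Of ε y₀ c₂ lam₂ kh₂₂ kc₂₂ p - gTrace ε y₀ kh₂₁ kc₂₁ p.1 * k₁₂ p
  bc_kh₂₁ : ∀ x ∈ Icc (0 : ℝ) 1,
    kh₂₁ (x, 0) = -((1 - foldRatio y₀ ^ 2) / (1 + foldRatio y₀ ^ 2)) * kc₂₁ (x, 0)
      + 2 * foldRatio y₀ ^ 3 / (1 + foldRatio y₀ ^ 2) * kc₂₂ (x, 0)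
  bc_kh₂₂ : ∀ x ∈ Icc (0 : ℝ) 1,
    kh₂₂ (x, 0) = 2 / (foldRatio y₀ * (1 + foldRatio y₀ ^ 2)) * kc₂₁ (x, 0)
      + (1 - foldRatio y₀ ^ 2) / (1 + foldRatio y₀ ^ 2) * kc₂₂ (x, 0)
  bc_kc₂₁ : ∀ x ∈ Icc (0 : ℝ) 1,
    kc₂₁ (x, x) = -((√(eps1 ε y₀) - √(eps2 ε y₀)) / (√(eps1 ε y₀) + √(eps2 ε y₀))) * kh₂₁ (x, x)
  bc_kc₂₂ : ∀ x ∈ Icc (0 : ℝ) 1,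
    kc₂₂ (x, x) = -((lam₂ x + c₂) / (2 * √(eps2 ε y₀)))

end FoldedKernel

end

/-!
Integrating every equation along its characteristics from the edge on which its unknown is
prescribed turns the system into a fixed-point equation. The integrals contract in an exponentially
weighted sup norm and the reflections at the two edges contract once the four unknowns are weighted
suitably, so there is exactly one continuous solution.

Since `k̂₂ᵢ` and `ǩ₂ᵢ` have the same source, `(ǩ + k̂) dx + √(ε₂/εᵢ) (ǩ - k̂) dy` is exact, as in
d'Alembert's formula; hence `k₂ᵢ` is `C¹`. The source, although only continuous in `x`, is then
differentiable in `y`, and this suffices for its integrals along characteristics to be `C¹`. The ray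
across which `∂_y k₁₂` jumps is transversal to the characteristics of slope `±1` and does no harm.
What remains is the trace `H` of `k̂₂₁` on the axis: following characteristics to the diagonal and
back yields `H x = κ H (ρ x) + F x` with `F` of class `C¹` and `|κ| < 1`, so `H` is `C¹` as well.
-/

noncomputable section

namespace FoldedKernel

open MeasureTheory Filter Topology

/-- The linear form `u dx + v dy` on the plane. -/
def planeForm (u v : ℝ) : ℝ × ℝ →L[ℝ] ℝ :=
  u • ContinuousLinearMap.fst ℝ ℝ ℝ + v • ContinuousLinearMap.snd ℝ ℝ ℝ

@[simp] theorem planeForm_apply (u v : ℝ) (p : ℝ × ℝ) : planeForm u v p = u * p.1 + v * p.2 := rfl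

theorem contDiff_planeForm {n : WithTop ℕ∞} {E : Type*} [NormedAddCommGroup E] [NormedSpace ℝ E]
    {u v : E → ℝ} (hu : ContDiff ℝ n u) (hv : ContDiff ℝ n v) :
    ContDiff ℝ n fun p => planeForm (u p) (v p) :=
  (hu.smul contDiff_const).add (hv.smul contDiff_const)

theorem continuous_planeForm {E : Type*} [TopologicalSpace E]
    {u v : E → ℝ} (hu : Continuous u) (hv : Continuous v) :
    Continuous fun p => planeForm (u p) (v p) :=
  (hu.smul continuous_const).add (hv.smul continuous_const)

theorem hasFDerivAt_of_continuous_partials {f fx fy : ℝ × ℝ → ℝ}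
    (hx : ∀ p, HasDerivAt (fun x => f (x, p.2)) (fx p) p.1)
    (hy : ∀ p, HasDerivAt (fun y => f (p.1, y)) (fy p) p.2)
    (cx : Continuous fx) (cy : Continuous fy) (p : ℝ × ℝ) :
    HasFDerivAt f (planeForm (fx p) (fy p)) p := by
  have span : Continuous (ContinuousLinearMap.toSpanSingleton ℝ : ℝ → ℝ →L[ℝ] ℝ) :=
    (ContinuousLinearMap.toSpanSingletonCLE (𝕜 := ℝ) (E := ℝ)).continuous
  have h := hasStrictFDerivAt_uncurry_coprod (𝕜 := ℝ) (u := p) (f := fun x y => f (x, y))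
    (f₁ := fun x y => ContinuousLinearMap.toSpanSingleton ℝ (fx (x, y)))
    (f₂ := fun x y => ContinuousLinearMap.toSpanSingleton ℝ (fy (x, y)))
    (Eventually.of_forall fun v => (hx v).hasFDerivAt)
    (Eventually.of_forall fun v => (hy v).hasFDerivAt)
    (span.comp cx).continuousAt (span.comp cy).continuousAt
  have e : planeForm (fx p) (fy p) = (ContinuousLinearMap.toSpanSingleton ℝ (fx p)).coprod
      (ContinuousLinearMap.toSpanSingleton ℝ (fy p)) := by
    ext <;> simp
  rw [e]
  exact h.hasFDerivAt

theorem hasDerivAt_primitive {g : ℝ → ℝ} (hg : Continuous g) (l x : ℝ) :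
    HasDerivAt (fun s => ∫ t in l..s, g t) (g x) x :=
  intervalIntegral.integral_hasDerivAt_right (hg.intervalIntegrable _ _)
    (hg.stronglyMeasurableAtFilter _ _) hg.continuousAt

theorem contDiff_primitive {n : ℕ} {g : ℝ → ℝ} (hg : ContDiff ℝ n g) :
    ContDiff ℝ (n + 1) fun s => ∫ t in (0 : ℝ)..s, g t := by
  have h := hasDerivAt_primitive hg.continuous 0
  refine contDiff_succ_iff_deriv.2 ⟨fun x => (h x).differentiableAt, by simp, ?_⟩
  rwa [show (deriv fun s => ∫ t in (0 : ℝ)..s, g t) = g from funext fun x => (h x).deriv]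

theorem continuous_integral_snd {f : ℝ × ℝ → ℝ} (hf : Continuous f) {l u : ℝ × ℝ → ℝ}
    (hl : Continuous l) (hu : Continuous u) :
    Continuous fun p => ∫ t in l p..u p, f (p.1, t) := by
  have key : ∀ {v : ℝ × ℝ → ℝ}, Continuous v →
      Continuous fun p : ℝ × ℝ => ∫ t in (0 : ℝ)..v p, f (p.1, t) := fun hv =>
    intervalIntegral.continuous_parametric_intervalIntegral_of_continuous
      (f := fun (q : ℝ × ℝ) t => f (q.1, t)) (by simp only [Function.uncurry_def]; fun_prop) hv
  refine ((key hu).sub (key hl)).congr fun p => ?_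
  have hc : Continuous fun t => f (p.1, t) := by fun_prop
  exact intervalIntegral.integral_interval_sub_left (hc.intervalIntegrable _ _)
    (hc.intervalIntegrable _ _)

theorem exists_bound_on_square {f : ℝ × ℝ → ℝ} (hf : Continuous f) (R : ℝ) :
    ∃ C : ℝ, 0 ≤ C ∧ ∀ z y : ℝ, |z| ≤ R → |y| ≤ R → |f (z, y)| ≤ C := by
  obtain ⟨C, hC⟩ := ((isCompact_Icc (a := -R) (b := R)).prod
    (isCompact_Icc (a := -R) (b := R))).exists_bound_of_continuousOn hf.continuousOn
  exact ⟨max C 0, le_max_right _ _, fun z y hz hy =>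
    (hC (z, y) ⟨abs_le.1 hz, abs_le.1 hy⟩).trans (le_max_left _ _)⟩

/-- `S` is continuous, locally Lipschitz in `y`, and almost everywhere on every line of slope `m`
it has the partial derivative `Sy` in `y`, which is continuous there. This is what remains of `C¹`
regularity when the gradient jumps across a ray that the lines of slope `m` cross transversally. -/
structure RegularAlong (m : ℝ) (S Sy : ℝ × ℝ → ℝ) : Prop where
  cont : Continuous S
  meas : Measurable Sy
  deriv : ∀ w : ℝ, ∀ᵐ z : ℝ, HasDerivAt (fun y => S (z, y)) (Sy (z, w + m * z)) (w + m * z) ∧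
    ContinuousAt Sy (z, w + m * z)
  bdd : ∀ R : ℝ, ∃ C : ℝ, 0 ≤ C ∧ ∀ z y : ℝ, |z| ≤ R → |y| ≤ R → |Sy (z, y)| ≤ C
  lip : ∀ R : ℝ, ∃ C : ℝ, 0 ≤ C ∧ ∀ z y y' : ℝ, |z| ≤ R → |y| ≤ R → |y'| ≤ R →
    |S (z, y) - S (z, y')| ≤ C * |y - y'|

namespace RegularAlong

variable {m : ℝ} {S Sy T Ty : ℝ × ℝ → ℝ}

theorem of_continuous (hS : Continuous S) (hSy : Continuous Sy)
    (h : ∀ p : ℝ × ℝ, HasDerivAt (fun y => S (p.1, y)) (Sy p) p.2) :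
    RegularAlong m S Sy where
  cont := hS
  meas := hSy.measurable
  deriv w := Eventually.of_forall fun z => ⟨h (z, w + m * z), hSy.continuousAt⟩
  bdd := exists_bound_on_square hSy
  lip R := by
    obtain ⟨C, hC0, hC⟩ := exists_bound_on_square hSy R
    refine ⟨C, hC0, fun z y y' hz hy hy' => ?_⟩
    have := (convex_Icc (-R) R).norm_image_sub_le_of_norm_hasDerivWithin_le
      (f := fun y => S (z, y)) (f' := fun y => Sy (z, y)) (C := C) (x := y') (y := y)
      (fun x _ => (h (z, x)).hasDerivWithinAt) (fun x hx => hC z x hz (abs_le.2 hx))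
      (abs_le.1 hy') (abs_le.1 hy)
    simpa using this

theorem of_contDiff (hS : ContDiff ℝ 1 S) : RegularAlong m S fun p => fderiv ℝ S p (0, 1) := by
  refine .of_continuous hS.continuous
    ((hS.continuous_fderiv one_ne_zero).clm_apply continuous_const) fun p => ?_
  have h1 : HasFDerivAt S (fderiv ℝ S p) (p.1, p.2) :=
    (hS.differentiable one_ne_zero p).hasFDerivAt
  exact h1.comp_hasDerivAt (x := p.2) (f := fun y => (p.1, y))
    ((hasDerivAt_const p.2 p.1).prodMk (hasDerivAt_id p.2))

theorem of_fst {φ : ℝ → ℝ} (hφ : Continuous φ) : RegularAlong m (fun p => φ p.1) 0 :=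
  .of_continuous (by fun_prop) continuous_zero fun p => hasDerivAt_const p.2 (φ p.1)

theorem mul (hS : RegularAlong m S Sy) (hT : RegularAlong m T Ty) :
    RegularAlong m (fun p => S p * T p) (fun p => Sy p * T p + S p * Ty p) where
  cont := hS.cont.mul hT.cont
  meas := (hS.meas.mul hT.cont.measurable).add (hS.cont.measurable.mul hT.meas)
  deriv w := by
    filter_upwards [hS.deriv w, hT.deriv w] with z h1 h2
    exact ⟨h1.1.mul h2.1, (h1.2.mul hT.cont.continuousAt).add (hS.cont.continuousAt.mul h2.2)⟩
  bdd R := by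
    obtain ⟨C1, h1, H1⟩ := hS.bdd R
    obtain ⟨C2, h2, H2⟩ := hT.bdd R
    obtain ⟨C3, h3, H3⟩ := exists_bound_on_square hS.cont R
    obtain ⟨C4, h4, H4⟩ := exists_bound_on_square hT.cont R
    refine ⟨C1 * C4 + C3 * C2, by positivity, fun z y hz hy => (abs_add_le _ _).trans ?_⟩
    rw [abs_mul, abs_mul]
    gcongr
    exacts [H1 z y hz hy, H4 z y hz hy, H3 z y hz hy, H2 z y hz hy]
  lip R := by
    obtain ⟨C1, h1, H1⟩ := hS.lip R
    obtain ⟨C2, h2, H2⟩ := hT.lip R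
    obtain ⟨C3, h3, H3⟩ := exists_bound_on_square hS.cont R
    obtain ⟨C4, h4, H4⟩ := exists_bound_on_square hT.cont R
    refine ⟨C1 * C4 + C3 * C2, by positivity, fun z y y' hz hy hy' => ?_⟩
    rw [show S (z, y) * T (z, y) - S (z, y') * T (z, y') =
      (S (z, y) - S (z, y')) * T (z, y) + S (z, y') * (T (z, y) - T (z, y')) by ring]
    refine (abs_add_le _ _).trans ?_
    rw [abs_mul, abs_mul, add_mul, mul_right_comm, mul_assoc C3]
    gcongr
    exacts [H1 z y y' hz hy hy', H4 z y hz hy, H3 z y' hz hy', H2 z y y' hz hy hy']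

theorem add (hS : RegularAlong m S Sy) (hT : RegularAlong m T Ty) :
    RegularAlong m (fun p => S p + T p) (fun p => Sy p + Ty p) where
  cont := hS.cont.add hT.cont
  meas := hS.meas.add hT.meas
  deriv w := by
    filter_upwards [hS.deriv w, hT.deriv w] with z h1 h2
    exact ⟨h1.1.add h2.1, h1.2.add h2.2⟩
  bdd R := by
    obtain ⟨C1, h1, H1⟩ := hS.bdd R
    obtain ⟨C2, h2, H2⟩ := hT.bdd R
    exact ⟨C1 + C2, by positivity, fun z y hz hy =>
      (abs_add_le _ _).trans (add_le_add (H1 z y hz hy) (H2 z y hz hy))⟩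
  lip R := by
    obtain ⟨C1, h1, H1⟩ := hS.lip R
    obtain ⟨C2, h2, H2⟩ := hT.lip R
    refine ⟨C1 + C2, by positivity, fun z y y' hz hy hy' => ?_⟩
    rw [add_sub_add_comm, add_mul]
    exact (abs_add_le _ _).trans (add_le_add (H1 z y y' hz hy hy') (H2 z y y' hz hy hy'))

theorem measurable_line (h : RegularAlong m S Sy) (w : ℝ) :
    Measurable fun z => Sy (z, w + m * z) :=
  h.meas.comp (by fun_prop)

end RegularAlong

section LineIntegral

variable {m : ℝ} {S Sy : ℝ × ℝ → ℝ}

/-- The integral of `S` over `0 ≤ z ≤ q.1` along the line through `(0, q.2)` of slope `m`. -/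
def lineIntegral (m : ℝ) (S : ℝ × ℝ → ℝ) (q : ℝ × ℝ) : ℝ :=
  ∫ z in (0 : ℝ)..q.1, S (z, q.2 + m * z)

theorem continuous_lineIntegral (hS : Continuous S) : Continuous (lineIntegral m S) := by
  unfold lineIntegral
  refine intervalIntegral.continuous_parametric_intervalIntegral_of_continuous
    (f := fun (q : ℝ × ℝ) z => S (z, q.2 + m * z)) (s := fun q => q.1) ?_ continuous_fst
  simp only [Function.uncurry_def]
  fun_prop

theorem hasDerivAt_lineIntegral_fst (hS : Continuous S) (p : ℝ × ℝ) :
    HasDerivAt (fun β => lineIntegral m S (β, p.2)) (S (p.1, p.2 + m * p.1)) p.1 :=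
  hasDerivAt_primitive (g := fun z => S (z, p.2 + m * z)) (by fun_prop) 0 p.1

theorem abs_le_and_abs_line_le {z v w B : ℝ} (m : ℝ) (hz : |z| ≤ B) (hv : |v - w| ≤ 1) :
    |z| ≤ |w| + 1 + |m| * B + B ∧ |v + m * z| ≤ |w| + 1 + |m| * B + B := by
  have hB : 0 ≤ B := (abs_nonneg z).trans hz
  have hmB : 0 ≤ |m| * B := by positivity
  have hvw : |v| ≤ |w| + 1 := by linarith [abs_sub_abs_le_abs_sub v w]
  have hmz : |m * z| ≤ |m| * B := by rw [abs_mul]; gcongr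
  exact ⟨by linarith [abs_nonneg w], by linarith [abs_add_le v (m * z)]⟩

theorem hasDerivAt_lineIntegral_snd (h : RegularAlong m S Sy) (p : ℝ × ℝ) :
    HasDerivAt (fun w => lineIntegral m S (p.1, w)) (lineIntegral m Sy p) p.2 := by
  have hS := h.cont
  have hc : ∀ w, Continuous fun z => S (z, w + m * z) := fun w => by fun_prop
  obtain ⟨C, hC0, hC⟩ := h.lip (|p.2| + 1 + |m| * |p.1| + |p.1|)
  refine (intervalIntegral.hasDerivAt_integral_of_dominated_loc_of_lip (μ := volume)
    (F := fun w z => S (z, w + m * z)) (bound := fun _ => C)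
    (Metric.closedBall_mem_nhds p.2 one_pos)
    (Eventually.of_forall fun w => (hc w).aestronglyMeasurable) ((hc _).intervalIntegrable _ _)
    (h.measurable_line _).aestronglyMeasurable ?_ intervalIntegrable_const ?_).2
  · refine Eventually.of_forall fun z hz => LipschitzOnWith.of_dist_le_mul fun w hw w' hw' => ?_
    have hz' : |z| ≤ |p.1| := by simpa using abs_sub_left_of_mem_uIcc (uIoc_subset_uIcc hz)
    have := hC z (w + m * z) (w' + m * z) (abs_le_and_abs_line_le m hz' hw).1
      (abs_le_and_abs_line_le m hz' hw).2 (abs_le_and_abs_line_le m hz' hw').2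
    rw [add_sub_add_right_eq_sub] at this
    simpa [Real.dist_eq, abs_of_nonneg hC0] using this
  · filter_upwards [h.deriv p.2] with z hz _
    exact hz.1.comp_add_const (x := p.2) (a := m * z)

theorem RegularAlong.continuous_lineIntegral_deriv (h : RegularAlong m S Sy) :
    Continuous (lineIntegral m Sy) := by
  rw [continuous_iff_continuousAt]
  rintro ⟨β, w⟩
  obtain ⟨C, -, hC⟩ := h.bdd (|w| + 1 + |m| * (|β| + 1) + (|β| + 1))
  have hβ : β ∈ Ioo (-(|β| + 1)) (|β| + 1) :=
    ⟨by linarith [neg_abs_le β], by linarith [le_abs_self β]⟩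
  have h0 : (0 : ℝ) ∈ Ioo (-(|β| + 1)) (|β| + 1) := by
    constructor <;> linarith [abs_nonneg β]
  have := intervalIntegral.continuousAt_parametric_primitive_of_dominated (μ := volume)
    (F := fun (w : ℝ) z => Sy (z, w + m * z)) (x₀ := w) (b₀ := β) (a₀ := 0) (fun _ => C)
    (-(|β| + 1)) (|β| + 1) (fun w => (h.measurable_line w).aestronglyMeasurable) ?_
    intervalIntegrable_const ?_ h0 hβ (by simp)
  · exact this.comp (f := fun q : ℝ × ℝ => (q.2, q.1)) (x := (β, w)) (by fun_prop)
  · filter_upwards [Metric.closedBall_mem_nhds w one_pos] with v hv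
    refine (ae_restrict_iff' measurableSet_uIoc).2 (Eventually.of_forall fun z hz => ?_)
    rw [uIoc_of_le (h0.1.trans h0.2).le] at hz
    have hz' : |z| ≤ |β| + 1 := abs_le.2 ⟨hz.1.le, hz.2⟩
    exact hC z _ (abs_le_and_abs_line_le m hz' hv).1 (abs_le_and_abs_line_le m hz' hv).2
  · refine ae_restrict_of_ae ?_
    filter_upwards [h.deriv w] with z hz
    exact ContinuousAt.comp (f := fun w : ℝ => (z, w + m * z)) hz.2 (by fun_prop)

theorem hasFDerivAt_lineIntegral (h : RegularAlong m S Sy) (q : ℝ × ℝ) :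
    HasFDerivAt (lineIntegral m S)
      (planeForm (S (q.1, q.2 + m * q.1)) (lineIntegral m Sy q)) q := by
  have hS := h.cont
  exact hasFDerivAt_of_continuous_partials (fx := fun q => S (q.1, q.2 + m * q.1))
    (hasDerivAt_lineIntegral_fst h.cont) (hasDerivAt_lineIntegral_snd h) (by fun_prop)
    h.continuous_lineIntegral_deriv q

theorem contDiff_lineIntegral (h : RegularAlong m S Sy) : ContDiff ℝ 1 (lineIntegral m S) := by
  have hS := h.cont
  exact contDiff_one_iff_hasFDerivAt.2 ⟨_, continuous_planeForm
    (u := fun q : ℝ × ℝ => S (q.1, q.2 + m * q.1)) (by fun_prop)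
    h.continuous_lineIntegral_deriv, hasFDerivAt_lineIntegral h⟩

end LineIntegral

section Characteristics

variable {m b μ : ℝ} {G : ℝ → ℝ} {S Sy : ℝ × ℝ → ℝ}

/-- The abscissa at which the line of slope `m` through `p` meets the line `y = b x`. -/
def foot (m b : ℝ) (p : ℝ × ℝ) : ℝ := (p.2 - m * p.1) / (b - m)

/-- The integral of `S`, with respect to the abscissa, along the line of slope `m` from the line
`y = b x` to `p`. -/
def charIntegral (m b : ℝ) (S : ℝ × ℝ → ℝ) (p : ℝ × ℝ) : ℝ :=
  ∫ z in foot m b p..p.1, S (z, p.2 - m * p.1 + m * z)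

/-- The solution `f` of the transport equation `μ (∂ₓ f + m ∂_y f) = S` with `f (x, b x) = G x`. -/
def transport (m b μ : ℝ) (G : ℝ → ℝ) (S : ℝ × ℝ → ℝ) (p : ℝ × ℝ) : ℝ :=
  G (foot m b p) + 1 / μ * charIntegral m b S p

theorem foot_base (hmb : m ≠ b) (x : ℝ) : foot m b (x, b * x) = x := by
  rw [foot, div_eq_iff (sub_ne_zero.2 hmb.symm)]
  ring

theorem base_foot (hmb : m ≠ b) (p : ℝ × ℝ) :
    p.2 - m * p.1 + m * foot m b p = b * foot m b p := by
  have := sub_ne_zero.2 hmb.symm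
  rw [foot]
  field_simp
  ring

theorem transport_base (hmb : m ≠ b) (x : ℝ) : transport m b μ G S (x, b * x) = G x := by
  simp [transport, charIntegral, foot_base hmb]

@[fun_prop]
theorem continuous_foot : Continuous (foot m b) := by
  unfold foot
  fun_prop

@[fun_prop]
theorem contDiff_foot {n : WithTop ℕ∞} : ContDiff ℝ n (foot m b) := by
  unfold foot
  fun_prop

theorem hasFDerivAt_snd_sub_mul_fst (m : ℝ) (p : ℝ × ℝ) :
    HasFDerivAt (fun q : ℝ × ℝ => q.2 - m * q.1) (planeForm (-m) 1) p := by
  refine (hasFDerivAt_snd.sub (hasFDerivAt_fst.const_mul m)).congr_fderiv ?_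
  ext <;> simp

theorem hasFDerivAt_foot (p : ℝ × ℝ) :
    HasFDerivAt (foot m b) (planeForm (-m / (b - m)) (1 / (b - m))) p := by
  refine ((hasFDerivAt_snd_sub_mul_fst m p).mul_const (b - m)⁻¹).congr_fderiv ?_
  ext <;> simp [div_eq_inv_mul]

theorem charIntegral_eq_sub (hS : Continuous S) (p : ℝ × ℝ) :
    charIntegral m b S p = lineIntegral m S (p.1, p.2 - m * p.1) -
      lineIntegral m S (foot m b p, p.2 - m * p.1) := by
  have hc : Continuous fun z => S (z, p.2 - m * p.1 + m * z) := by fun_prop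
  exact (intervalIntegral.integral_interval_sub_left (hc.intervalIntegrable _ _)
    (hc.intervalIntegrable _ _)).symm

theorem continuous_charIntegral (hS : Continuous S) : Continuous (charIntegral m b S) := by
  rw [funext (charIntegral_eq_sub hS)]
  exact ((continuous_lineIntegral hS).comp (by fun_prop)).sub
    ((continuous_lineIntegral hS).comp (by fun_prop))

theorem RegularAlong.contDiff_charIntegral (h : RegularAlong m S Sy) :
    ContDiff ℝ 1 (charIntegral m b S) := by
  rw [funext (charIntegral_eq_sub h.cont)]
  exact ((contDiff_lineIntegral h).comp (by fun_prop)).sub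
    ((contDiff_lineIntegral h).comp (by fun_prop))

theorem RegularAlong.intervalIntegrable_line (h : RegularAlong m S Sy) (w l x : ℝ) :
    IntervalIntegrable (fun z => Sy (z, w + m * z)) volume l x := by
  obtain ⟨C, -, hC⟩ := h.bdd (|w| + 1 + |m| * (|l| + |x|) + (|l| + |x|))
  refine (intervalIntegrable_const (c := C)).mono_fun'
    (h.measurable_line w).aestronglyMeasurable ?_
  refine (ae_restrict_iff' measurableSet_uIoc).2 (Eventually.of_forall fun z hz => ?_)
  have hz' : |z| ≤ |l| + |x| := by
    have := abs_nonneg l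
    have := abs_nonneg x
    rcases (mem_uIoc.1 hz) with hz | hz <;>
      exact abs_le.2 ⟨by linarith [neg_abs_le l, neg_abs_le x],
        by linarith [le_abs_self l, le_abs_self x]⟩
  have := abs_le_and_abs_line_le (v := w) (w := w) m hz' (by simp)
  exact hC z _ this.1 this.2

theorem RegularAlong.hasFDerivAt_charIntegral (h : RegularAlong m S Sy) (hmb : m ≠ b)
    (p : ℝ × ℝ) :
    HasFDerivAt (charIntegral m b S)
      (planeForm
        (S p + m / (b - m) * S (foot m b p, b * foot m b p) - m * charIntegral m b Sy p)
        (charIntegral m b Sy p - 1 / (b - m) * S (foot m b p, b * foot m b p))) p := by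
  have hI : charIntegral m b Sy p = lineIntegral m Sy (p.1, p.2 - m * p.1) -
      lineIntegral m Sy (foot m b p, p.2 - m * p.1) :=
    (intervalIntegral.integral_interval_sub_left (h.intervalIntegrable_line _ _ _)
      (h.intervalIntegrable_line _ _ _)).symm
  have h0 := hasFDerivAt_snd_sub_mul_fst m p
  have h1 := (hasFDerivAt_lineIntegral h (p.1, p.2 - m * p.1)).comp p
    ((hasFDerivAt_fst (𝕜 := ℝ) (p := p)).prodMk h0)
  have h2 := (hasFDerivAt_lineIntegral h (foot m b p, p.2 - m * p.1)).comp p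
    ((hasFDerivAt_foot (m := m) (b := b) p).prodMk h0)
  rw [funext (charIntegral_eq_sub h.cont), hI]
  refine (h1.sub h2).congr_fderiv ?_
  ext <;> simp [base_foot hmb] <;> ring

theorem continuous_transport (hG : Continuous G) (hS : Continuous S) :
    Continuous (transport m b μ G S) :=
  (hG.comp continuous_foot).add (continuous_const.mul (continuous_charIntegral hS))

theorem RegularAlong.contDiff_transport (h : RegularAlong m S Sy) (hG : ContDiff ℝ 1 G) :
    ContDiff ℝ 1 (transport m b μ G S) :=
  (hG.comp contDiff_foot).add (contDiff_const.mul h.contDiff_charIntegral)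

theorem RegularAlong.fderiv_transport (h : RegularAlong m S Sy) (hmb : m ≠ b) (hμ : μ ≠ 0)
    (hG : ContDiff ℝ 1 G) (p : ℝ × ℝ) :
    μ * (fderiv ℝ (transport m b μ G S) p (1, 0) +
      m * fderiv ℝ (transport m b μ G S) p (0, 1)) = S p := by
  have hG' := ((hG.differentiable one_ne_zero (foot m b p)).hasDerivAt.hasFDerivAt.comp p
    (hasFDerivAt_foot p)).add ((h.hasFDerivAt_charIntegral hmb p).const_mul (1 / μ))
  rw [show transport m b μ G S = G ∘ foot m b + fun p => 1 / μ * charIntegral m b S p from rfl,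
    hG'.fderiv]
  have := sub_ne_zero.2 hmb.symm
  simp only [one_div, add_apply, ContinuousLinearMap.comp_apply, planeForm_apply, mul_one,
    mul_zero, add_zero, ContinuousLinearMap.toSpanSingleton_apply, smul_eq_mul, smul_apply,
    zero_add]
  field_simp
  ring

end Characteristics

section Potential

variable {ν μ : ℝ} {H C : ℝ → ℝ} {S h c W : ℝ × ℝ → ℝ}

/-- The integral of `S` over the vertical segment from `(p.1, 0)` to `p`. -/
def verticalIntegral (S : ℝ × ℝ → ℝ) (p : ℝ × ℝ) : ℝ := ∫ t in (0 : ℝ)..p.2, S (p.1, t)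

theorem continuous_verticalIntegral (hS : Continuous S) : Continuous (verticalIntegral S) :=
  continuous_integral_snd hS continuous_const continuous_snd

theorem regularAlong_verticalIntegral {m : ℝ} (hS : Continuous S) :
    RegularAlong m (verticalIntegral S) S :=
  .of_continuous (continuous_verticalIntegral hS) hS fun p =>
    hasDerivAt_primitive (g := fun t => S (p.1, t)) (by fun_prop) 0 p.2

/-- D'Alembert's potential: a primitive of `(h + c) dx + ν⁻¹ (c - h) dy`, where `h` and `c` are
transported with the same source `S` along the slopes `ν` and `-ν`, from the traces `H` on the
`x`-axis and `C` on the diagonal. -/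
def potential (ν μ : ℝ) (H C : ℝ → ℝ) (S : ℝ × ℝ → ℝ) (p : ℝ × ℝ) : ℝ :=
  (∫ t in (0 : ℝ)..foot ν 0 p, H t) + (1 + ν⁻¹) * (∫ t in (0 : ℝ)..foot (-ν) 1 p, C t) +
    ν⁻¹ / μ * (charIntegral (-ν) 1 (verticalIntegral S) p -
      charIntegral ν 0 (verticalIntegral S) p +
      ∫ t in (0 : ℝ)..foot (-ν) 1 p, verticalIntegral S (t, t))

theorem hasFDerivAt_potential (hν : 0 < ν) (hH : Continuous H) (hC : Continuous C)
    (hS : Continuous S) (p : ℝ × ℝ) :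
    HasFDerivAt (potential ν μ H C S)
      (planeForm (transport ν 0 μ H S p + transport (-ν) 1 μ C S p)
        (ν⁻¹ * (transport (-ν) 1 μ C S p - transport ν 0 μ H S p))) p := by
  have hΘ := continuous_verticalIntegral hS
  have hD : Continuous fun t => verticalIntegral S (t, t) := by fun_prop
  have h1 := (hasDerivAt_primitive hH 0 (foot ν 0 p)).hasFDerivAt.comp p (hasFDerivAt_foot p)
  have h2 := (hasDerivAt_primitive hC 0 (foot (-ν) 1 p)).hasFDerivAt.comp p (hasFDerivAt_foot p)
  have h3 := (hasDerivAt_primitive hD 0 (foot (-ν) 1 p)).hasFDerivAt.comp p (hasFDerivAt_foot p)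
  have h4 := (regularAlong_verticalIntegral hS).hasFDerivAt_charIntegral hν.ne' p
  have h5 := (regularAlong_verticalIntegral hS).hasFDerivAt_charIntegral
    (m := -ν) (b := 1) (by linarith) p
  refine ((h1.add (h2.const_mul (1 + ν⁻¹))).add
    (((h5.sub h4).add h3).const_mul (ν⁻¹ / μ))).congr_fderiv ?_
  have hν' : 1 + ν ≠ 0 := by positivity
  have e0 : verticalIntegral S (foot ν 0 p, 0) = 0 := by simp [verticalIntegral]
  ext <;> simp [transport, e0] <;> field_simp <;> ring

theorem contDiff_of_hasFDerivAt_planeForm {n : ℕ} {u v : ℝ × ℝ → ℝ}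
    (hW : ∀ p, HasFDerivAt W (planeForm (u p) (v p)) p) (hu : ContDiff ℝ n u)
    (hv : ContDiff ℝ n v) : ContDiff ℝ (n + 1) W := by
  refine contDiff_succ_iff_fderiv.2 ⟨fun p => (hW p).differentiableAt, by simp, ?_⟩
  rw [show fderiv ℝ W = fun p => planeForm (u p) (v p) from funext fun p => (hW p).fderiv]
  exact contDiff_planeForm hu hv

/-- The function `k` with `2 μ ∂ₓ k = h + c` and diagonal values `k (y, y) = ∫ β` over `[0, y]`. -/
def recover (μ : ℝ) (β : ℝ → ℝ) (h c : ℝ × ℝ → ℝ) (p : ℝ × ℝ) : ℝ :=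
  (∫ z in (0 : ℝ)..p.2, β z) + 1 / (2 * μ) * ∫ z in p.2..p.1, (c (z, p.2) + h (z, p.2))

theorem integral_horizontal_of_potential
    (hW : ∀ p, HasFDerivAt W (planeForm (h p + c p) (ν⁻¹ * (c p - h p))) p)
    (hh : Continuous h) (hc : Continuous c) (p : ℝ × ℝ) :
    ∫ z in p.2..p.1, (c (z, p.2) + h (z, p.2)) = W p - W (p.2, p.2) := by
  refine intervalIntegral.integral_eq_sub_of_hasDerivAt (f := fun z => W (z, p.2)) (fun z _ => ?_)
    (Continuous.intervalIntegrable (by fun_prop) _ _)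
  refine ((hW (z, p.2)).comp_hasDerivAt z
    ((hasDerivAt_id z).prodMk (hasDerivAt_const z p.2))).congr_deriv ?_
  simp [add_comm]

theorem integral_diagonal_of_potential
    (hW : ∀ p, HasFDerivAt W (planeForm (h p + c p) (ν⁻¹ * (c p - h p))) p)
    (hh : Continuous h) (hc : Continuous c) (y : ℝ) :
    ∫ t in (0 : ℝ)..y, (h (t, t) + c (t, t) + ν⁻¹ * (c (t, t) - h (t, t))) =
      W (y, y) - W (0, 0) := by
  refine intervalIntegral.integral_eq_sub_of_hasDerivAt (f := fun t => W (t, t)) (fun t _ => ?_)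
    (Continuous.intervalIntegrable (by fun_prop) _ _)
  refine ((hW (t, t)).comp_hasDerivAt (f := fun t => (t, t)) t
    ((hasDerivAt_id t).prodMk (hasDerivAt_id t))).congr_deriv ?_
  simp

theorem recover_eq_of_potential {β : ℝ → ℝ} (hμ : μ ≠ 0)
    (hW : ∀ p, HasFDerivAt W (planeForm (h p + c p) (ν⁻¹ * (c p - h p))) p)
    (hh : Continuous h) (hc : Continuous c)
    (hβ : ∀ t ∈ Icc (0 : ℝ) 1,
      h (t, t) + c (t, t) + ν⁻¹ * (c (t, t) - h (t, t)) = 2 * μ * β t)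
    {p : ℝ × ℝ} (hp : p ∈ triangle) :
    recover μ β h c p = 1 / (2 * μ) * (W p - W (0, 0)) := by
  have hdiag := integral_diagonal_of_potential hW hh hc p.2
  have hcongr : ∫ t in (0 : ℝ)..p.2, (h (t, t) + c (t, t) + ν⁻¹ * (c (t, t) - h (t, t))) =
      ∫ t in (0 : ℝ)..p.2, 2 * μ * β t :=
    intervalIntegral.integral_congr fun t ht => by
      rw [uIcc_of_le hp.1] at ht
      exact hβ t ⟨ht.1, ht.2.trans (hp.2.1.trans hp.2.2)⟩
  rw [hcongr, intervalIntegral.integral_const_mul] at hdiag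
  rw [recover, integral_horizontal_of_potential hW hh hc]
  field_simp
  linarith

theorem continuous_recover {β : ℝ → ℝ} (hβ : Continuous β) (hh : Continuous h)
    (hc : Continuous c) : Continuous (recover μ β h c) := by
  have h1 : Continuous fun x => ∫ z in (0 : ℝ)..x, β z :=
    continuous_iff_continuousAt.2 fun x => (hasDerivAt_primitive hβ 0 x).continuousAt
  have h2 : Continuous fun p : ℝ × ℝ => ∫ z in p.2..p.1, (c (z, p.2) + h (z, p.2)) :=
    (continuous_integral_snd (f := fun q => c (q.2, q.1) + h (q.2, q.1)) (l := Prod.fst)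
      (u := Prod.snd) (by fun_prop) continuous_fst continuous_snd).comp continuous_swap
  exact (h1.comp continuous_snd).add (continuous_const.mul h2)

end Potential

section Extension

/-- The nearest point of `[0, 1]`. -/
def clamp (x : ℝ) : ℝ := projIcc 0 1 zero_le_one x

theorem clamp_mem (x : ℝ) : clamp x ∈ Icc (0 : ℝ) 1 := (projIcc 0 1 zero_le_one x).2

theorem clamp_of_mem {x : ℝ} (hx : x ∈ Icc (0 : ℝ) 1) : clamp x = x := by
  rw [clamp, projIcc_of_mem zero_le_one hx]

@[fun_prop]
theorem continuous_clamp : Continuous clamp := continuous_subtype_val.comp continuous_projIcc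

theorem exists_contDiff_extension {f : ℝ → ℝ} (hf : ContDiffOn ℝ 1 f (Icc 0 1)) :
    ∃ g : ℝ → ℝ, ContDiff ℝ 1 g ∧ EqOn g f (Icc 0 1) := by
  have hd : ContinuousOn (derivWithin f (Icc 0 1)) (Icc 0 1) :=
    hf.continuousOn_derivWithin (uniqueDiffOn_Icc one_pos) le_rfl
  have hc : Continuous fun t => derivWithin f (Icc 0 1) (clamp t) :=
    hd.comp_continuous continuous_clamp clamp_mem
  refine ⟨fun x => f 0 + ∫ t in (0 : ℝ)..x, derivWithin f (Icc 0 1) (clamp t),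
    contDiff_const.add (by simpa using contDiff_primitive (n := 0) (contDiff_zero.2 hc)),
    fun x hx => ?_⟩
  have := intervalIntegral.integral_eq_sub_of_hasDerivAt_of_le (f := f)
    (f' := fun t => derivWithin f (Icc 0 1) (clamp t)) hx.1
    (hf.continuousOn.mono (Icc_subset_Icc_right hx.2)) (fun t ht => ?_) (hc.intervalIntegrable _ _)
  · dsimp only
    linarith
  · have ht' : t ∈ Icc (0 : ℝ) 1 := ⟨ht.1.le, ht.2.le.trans hx.2⟩
    rw [clamp_of_mem ht']
    exact ((hf.differentiableOn one_ne_zero t ht').hasDerivWithinAt).hasDerivAt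
      (Icc_mem_nhds ht.1 (ht.2.trans_le hx.2))

variable {α β : ℝ} {p : ℝ × ℝ} {k : ℝ × ℝ → ℝ}

/-- The closed triangle between the lines of slopes `α` and `β` with `0 ≤ x ≤ 1`. -/
def sector (α β : ℝ) : Set (ℝ × ℝ) :=
  {p | p.1 ∈ Icc (0 : ℝ) 1 ∧ α * p.1 ≤ p.2 ∧ p.2 ≤ β * p.1}

theorem triangle_eq_sector : triangle = sector 0 1 := by
  ext p
  simp only [triangle, sector, mem_ofPred_eq, mem_Icc, zero_mul, one_mul]
  constructor
  · rintro ⟨h1, h2, h3⟩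
    exact ⟨⟨h1.trans h2, h3⟩, h1, h2⟩
  · rintro ⟨⟨_, h3⟩, h1, h2⟩
    exact ⟨h1, h2, h3⟩

theorem convex_sector (α β : ℝ) : Convex ℝ (sector α β) := by
  rintro p ⟨⟨h1, h2⟩, h3, h4⟩ q ⟨⟨h1', h2'⟩, h3', h4'⟩ s t hs ht hst
  simp only [sector, mem_ofPred_eq, mem_Icc, Prod.fst_add, Prod.smul_fst, Prod.snd_add,
    Prod.smul_snd, smul_eq_mul]
  refine ⟨⟨by positivity, ?_⟩, ?_, ?_⟩
  · nlinarith
  · nlinarith [mul_le_mul_of_nonneg_left h3 hs, mul_le_mul_of_nonneg_left h3' ht]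
  · nlinarith [mul_le_mul_of_nonneg_left h4 hs, mul_le_mul_of_nonneg_left h4' ht]

theorem uniqueDiffOn_sector (h : α < β) : UniqueDiffOn ℝ (sector α β) := by
  refine uniqueDiffOn_convex (convex_sector α β) ⟨(1 / 2, (α + β) / 2 * (1 / 2)), ?_⟩
  have ho : IsOpen {p : ℝ × ℝ | 0 < p.1 ∧ p.1 < 1 ∧ α * p.1 < p.2 ∧ p.2 < β * p.1} := by
    refine (isOpen_lt (by fun_prop) (by fun_prop)).and ((isOpen_lt (by fun_prop) (by fun_prop)).and
      ((isOpen_lt (by fun_prop) (by fun_prop)).and (isOpen_lt (by fun_prop) (by fun_prop))))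
  refine interior_maximal (fun p hp => ?_) ho ?_
  · exact ⟨⟨hp.1.le, hp.2.1.le⟩, hp.2.2.1.le, hp.2.2.2.le⟩
  · refine ⟨by norm_num, by norm_num, ?_, ?_⟩ <;> dsimp only <;> linarith

/-- A continuous retraction of the plane onto `sector α β`. -/
def sectorRetract (α β : ℝ) (p : ℝ × ℝ) : ℝ × ℝ :=
  (clamp p.1, max (α * clamp p.1) (min p.2 (β * clamp p.1)))

theorem continuous_sectorRetract (α β : ℝ) : Continuous (sectorRetract α β) := by
  unfold sectorRetract
  fun_prop

theorem sectorRetract_mem (h : α ≤ β) (p : ℝ × ℝ) : sectorRetract α β p ∈ sector α β :=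
  ⟨clamp_mem p.1, le_max_left _ _,
    max_le (mul_le_mul_of_nonneg_right h (clamp_mem p.1).1) (min_le_right _ _)⟩

theorem sectorRetract_of_mem (hp : p ∈ sector α β) : sectorRetract α β p = p := by
  obtain ⟨h1, h2, h3⟩ := hp
  simp [sectorRetract, clamp_of_mem h1, h2, h3]

theorem integral_fderivWithin_snd (hk : ContDiffOn ℝ 1 k (sector α β)) {x y y' : ℝ}
    (hy : (x, y) ∈ sector α β) (hy' : (x, y') ∈ sector α β) (hle : y' ≤ y)
    (hc : Continuous fun p => fderivWithin ℝ k (sector α β) (sectorRetract α β p) (0, 1)) :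
    ∫ t in y'..y, fderivWithin ℝ k (sector α β) (sectorRetract α β (x, t)) (0, 1) =
      k (x, y) - k (x, y') := by
  have hseg : ∀ t ∈ Icc y' y, (x, t) ∈ sector α β := fun t ht =>
    ⟨hy.1, hy'.2.1.trans ht.1, ht.2.trans hy.2.2⟩
  refine intervalIntegral.integral_eq_sub_of_hasDerivAt_of_le (f := fun t => k (x, t)) hle
    (hk.continuousOn.comp (by fun_prop) hseg) (fun t ht => ?_)
    (Continuous.intervalIntegrable (hc.comp (by fun_prop : Continuous fun t : ℝ => (x, t))) _ _)
  have ht' := hseg t (Ioo_subset_Icc_self ht)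
  rw [sectorRetract_of_mem ht']
  have h1 := (hk.differentiableOn one_ne_zero (x, t) ht').hasFDerivWithinAt
  have h2 := h1.comp_hasDerivWithinAt (s := Icc y' y) t
    (f := fun t => (x, t)) ((hasDerivWithinAt_const _ _ _).prodMk (hasDerivWithinAt_id _ _)) hseg
  exact h2.hasDerivAt (Icc_mem_nhds ht.1 ht.2)

theorem exists_snd_differentiable_extension (h : α < β) (hk : ContDiffOn ℝ 1 k (sector α β)) :
    ∃ g gy : ℝ × ℝ → ℝ, Continuous g ∧ Continuous gy ∧
      (∀ p : ℝ × ℝ, HasDerivAt (fun y => g (p.1, y)) (gy p) p.2) ∧ EqOn g k (sector α β) := by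
  set ky : ℝ × ℝ → ℝ :=
    fun p => fderivWithin ℝ k (sector α β) (sectorRetract α β p) (0, 1) with hky
  have cky : Continuous ky :=
    ((hk.continuousOn_fderivWithin (uniqueDiffOn_sector h) le_rfl).clm_apply
      continuousOn_const).comp_continuous (continuous_sectorRetract α β) (sectorRetract_mem h.le)
  have base_mem : ∀ x ∈ Icc (0 : ℝ) 1, (x, α * x) ∈ sector α β := fun x hx =>
    ⟨hx, le_rfl, mul_le_mul_of_nonneg_right h.le hx.1⟩
  refine ⟨fun p => k (clamp p.1, α * clamp p.1) + ∫ t in α * clamp p.1..p.2, ky (p.1, t), ky,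
    .add ?_ (continuous_integral_snd cky (by fun_prop) (by fun_prop)), cky, fun p => ?_,
    fun p hp => ?_⟩
  · exact hk.continuousOn.comp_continuous (by fun_prop) fun p => base_mem _ (clamp_mem p.1)
  · have hc : Continuous fun t => ky (p.1, t) := by fun_prop
    exact (hasDerivAt_primitive hc (α * clamp p.1) p.2).const_add (k (clamp p.1, α * clamp p.1))
  · have := integral_fderivWithin_snd hk hp (base_mem p.1 hp.1) hp.2.1 cky
    simp only [clamp_of_mem hp.1, hky, this]
    ring

theorem exists_regular_extension (hk : ContDiffOn ℝ 1 k triangle) :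
    ∃ g gy : ℝ × ℝ → ℝ, EqOn g k triangle ∧ ∀ m, RegularAlong m g gy := by
  rw [triangle_eq_sector] at hk ⊢
  obtain ⟨g, gy, cg, cgy, hg, e⟩ := exists_snd_differentiable_extension one_pos hk
  exact ⟨g, gy, e, fun m => .of_continuous cg cgy hg⟩

theorem hasDerivAt_comp_max_and_continuousAt {a : ℝ} {f fy : ℝ × ℝ → ℝ} (hfy : Continuous fy)
    (h : ∀ p : ℝ × ℝ, HasDerivAt (fun y => f (p.1, y)) (fy p) p.2) {p : ℝ × ℝ}
    (hp : p.2 ≠ a * p.1) :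
    HasDerivAt (fun y => f (p.1, max y (a * p.1))) (if p.2 ≤ a * p.1 then 0 else fy p) p.2 ∧
      ContinuousAt (fun p : ℝ × ℝ => if p.2 ≤ a * p.1 then 0 else fy p) p := by
  rcases lt_or_gt_of_ne hp with hlt | hgt
  · refine ⟨?_, (continuousAt_const (y := 0)).congr ?_⟩
    · rw [if_pos hlt.le]
      refine (hasDerivAt_const _ (f (p.1, a * p.1))).congr_of_eventuallyEq ?_
      filter_upwards [eventually_lt_nhds hlt] with y hy
      rw [max_eq_right hy.le]
    · have hopen : IsOpen {p : ℝ × ℝ | p.2 < a * p.1} := isOpen_lt (by fun_prop) (by fun_prop)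
      filter_upwards [hopen.mem_nhds hlt] with q hq
      rw [if_pos (le_of_lt hq)]
  · refine ⟨?_, hfy.continuousAt.congr ?_⟩
    · rw [if_neg hgt.not_ge]
      refine (h p).congr_of_eventuallyEq ?_
      filter_upwards [eventually_gt_nhds hgt] with y hy
      rw [max_eq_left hy.le]
    · have hopen : IsOpen {p : ℝ × ℝ | a * p.1 < p.2} := isOpen_lt (by fun_prop) (by fun_prop)
      filter_upwards [hopen.mem_nhds hgt] with q hq
      rw [if_neg (not_le_of_gt hq)]

theorem RegularAlong.comp_max {a m : ℝ} {f fy : ℝ × ℝ → ℝ} (hm : m ≠ a) (hf : Continuous f)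
    (hfy : Continuous fy) (h : ∀ p : ℝ × ℝ, HasDerivAt (fun y => f (p.1, y)) (fy p) p.2) :
    RegularAlong m (fun p => f (p.1, max p.2 (a * p.1)))
      fun p => if p.2 ≤ a * p.1 then 0 else fy p where
  cont := by fun_prop
  meas := .ite (measurableSet_le (by fun_prop) (by fun_prop)) measurable_const hfy.measurable
  deriv w := by
    have hne : ∀ᵐ z : ℝ, z ≠ w / (a - m) := by simp [ae_iff]
    filter_upwards [hne] with z hz
    have hz' : w + m * z ≠ a * z := fun h => hz <| by
      rw [eq_div_iff (sub_ne_zero.2 hm.symm)]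
      linarith
    exact hasDerivAt_comp_max_and_continuousAt hfy h (p := (z, w + m * z)) hz'
  bdd R := by
    obtain ⟨C, hC0, hC⟩ := exists_bound_on_square hfy R
    refine ⟨C, hC0, fun z y hz hy => ?_⟩
    dsimp only
    split_ifs
    exacts [by simpa using hC0, hC z y hz hy]
  lip R := by
    obtain ⟨C, hC0, hC⟩ := (RegularAlong.of_continuous (m := m) hf hfy h).lip (max R (|a| * R))
    refine ⟨C, hC0, fun z y y' hz hy hy' => ?_⟩
    have bound : ∀ t, |t| ≤ R → |max t (a * z)| ≤ max R (|a| * R) := fun t ht =>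
      abs_max_le_max_abs_abs.trans (max_le_max ht (by rw [abs_mul]; gcongr))
    refine (hC z _ _ (hz.trans (le_max_left _ _)) (bound y hy) (bound y' hy')).trans ?_
    have hmax := abs_max_sub_max_le_max y (a * z) y' (a * z)
    rw [sub_self, abs_zero, max_eq_left (abs_nonneg (y - y'))] at hmax
    exact mul_le_mul_of_nonneg_left hmax hC0

theorem exists_piecewise_regular_extension {a : ℝ} (ha : 0 < a) (ha1 : a < 1)
    (hl : ContDiffOn ℝ 1 k (sector 0 a)) (hu : ContDiffOn ℝ 1 k (sector a 1)) :
    ∃ g : ℝ × ℝ → ℝ, EqOn g k triangle ∧ ∀ m, m ≠ a → ∃ gy, RegularAlong m g gy := by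
  rw [triangle_eq_sector]
  obtain ⟨L, Ly, cL, cLy, hL, eL⟩ := exists_snd_differentiable_extension ha hl
  obtain ⟨U, Uy, cU, cUy, hU, eU⟩ := exists_snd_differentiable_extension ha1 hu
  refine ⟨fun p => L p + ((U (p.1, max p.2 (a * p.1)) - L (p.1, max p.2 (a * p.1))) +
    (L (p.1, a * p.1) - U (p.1, a * p.1))), fun p hp => ?_, fun m hm => ⟨_, .add
      (.of_continuous cL cLy hL) (.add (.comp_max (f := fun p => U p - L p) hm (cU.sub cL)
        (cUy.sub cLy) fun p => (hU p).sub (hL p)) (.of_fst (φ := fun x => L (x, a * x) -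
          U (x, a * x)) (by fun_prop)))⟩⟩
  obtain ⟨hx, h0, h1⟩ := hp
  rcases le_total p.2 (a * p.1) with hy | hy
  · simp [max_eq_right hy, eL ⟨hx, h0, hy⟩]
  · have hray := mul_le_mul_of_nonneg_right ha.le hx.1
    have hray' := mul_le_mul_of_nonneg_right ha1.le hx.1
    simp [max_eq_left hy, eU ⟨hx, hy, h1⟩, eL (x := (p.1, a * p.1)) ⟨hx, hray, le_rfl⟩,
      eU (x := (p.1, a * p.1)) ⟨hx, le_rfl, hray'⟩]

end Extension

section Triangle

variable {m b μ : ℝ} {S S' : ℝ × ℝ → ℝ} {G G' : ℝ → ℝ} {p : ℝ × ℝ}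

theorem convex_triangle : Convex ℝ triangle := by
  rw [triangle_eq_sector]
  exact convex_sector 0 1

theorem uniqueDiffOn_triangle : UniqueDiffOn ℝ triangle := by
  rw [triangle_eq_sector]
  exact uniqueDiffOn_sector one_pos

theorem isCompact_triangle : IsCompact triangle := by
  refine (isCompact_Icc.prod isCompact_Icc).of_isClosed_subset
    (s := Icc (0 : ℝ) 1 ×ˢ Icc (0 : ℝ) 1) ?_ fun p hp => ?_
  · exact (isClosed_le continuous_const continuous_snd).inter
      ((isClosed_le continuous_snd continuous_fst).inter
        (isClosed_le continuous_fst continuous_const))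
  · exact ⟨⟨hp.1.trans hp.2.1, hp.2.2⟩, hp.1, hp.2.1.trans hp.2.2⟩

theorem fst_mem_of_mem_triangle (hp : p ∈ triangle) : p.1 ∈ Icc (0 : ℝ) 1 :=
  ⟨hp.1.trans hp.2.1, hp.2.2⟩

theorem snd_mem_of_mem_triangle (hp : p ∈ triangle) : p.2 ∈ Icc (0 : ℝ) 1 :=
  ⟨hp.1, hp.2.1.trans hp.2.2⟩

theorem diagonal_mem_triangle {x : ℝ} (hx : x ∈ Icc (0 : ℝ) 1) : (x, x) ∈ triangle :=
  ⟨hx.1, le_rfl, hx.2⟩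

theorem horizontal_mem_triangle (hp : p ∈ triangle) {z : ℝ} (hz : z ∈ Icc p.2 p.1) :
    (z, p.2) ∈ triangle :=
  ⟨hp.1, hz.1, hz.2.trans hp.2.2⟩

/-- Following the line of slope `m` backwards in `x` from a point of the triangle, one leaves the
triangle through the edge `y = b x`. -/
structure IsInflow (m b : ℝ) : Prop where
  ne : m ≠ b
  base_mem : ∀ x ∈ Icc (0 : ℝ) 1, (x, b * x) ∈ triangle
  foot_mem : ∀ p ∈ triangle, foot m b p ∈ Icc 0 p.1

theorem isInflow_axis (hm : 1 ≤ m) : IsInflow m 0 where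
  ne := by linarith
  base_mem x hx := by simpa [triangle] using hx
  foot_mem p hp := by
    obtain ⟨h0, h1, -⟩ := hp
    have : 0 < m := by linarith
    have hfoot : foot m 0 p = p.1 - p.2 / m := by
      rw [foot, zero_sub]
      field_simp
      ring
    have : p.2 / m ≤ p.2 := div_le_self h0 hm
    have : 0 ≤ p.2 / m := by positivity
    rw [hfoot]
    constructor <;> linarith

theorem isInflow_diagonal (hm : m < 0) : IsInflow m 1 where
  ne := by linarith
  base_mem x hx := by simpa using diagonal_mem_triangle hx
  foot_mem p hp := by
    obtain ⟨h0, h1, -⟩ := hp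
    have hm1 : 0 < 1 - m := by linarith
    have := mul_nonneg (neg_nonneg.2 hm.le) (h0.trans h1)
    rw [foot, mem_Icc, le_div_iff₀ hm1, div_le_iff₀ hm1]
    constructor <;> linarith

theorem IsInflow.foot_mem_Icc (h : IsInflow m b) (hp : p ∈ triangle) :
    foot m b p ∈ Icc (0 : ℝ) 1 :=
  Icc_subset_Icc_right hp.2.2 (h.foot_mem p hp)

theorem IsInflow.line_mem (h : IsInflow m b) (hp : p ∈ triangle) {z : ℝ}
    (hz : z ∈ Icc (foot m b p) p.1) : (z, p.2 - m * p.1 + m * z) ∈ triangle := by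
  set w := p.2 - m * p.1 with hw
  have hline : ∀ t, AffineMap.lineMap ((0 : ℝ), w) (1, w + m) t = (t, w + m * t) := fun t => by
    simp [AffineMap.lineMap_apply, mul_comm, add_comm]
  have hconv := (convex_triangle.affine_preimage
    (AffineMap.lineMap (k := ℝ) ((0 : ℝ), w) (1, w + m))).ordConnected
  have hfoot : (foot m b p, w + m * foot m b p) ∈ triangle := by
    rw [hw, base_foot h.ne]
    exact h.base_mem _ (h.foot_mem_Icc hp)
  have hend : (p.1, w + m * p.1) ∈ triangle := by simpa [hw] using hp
  have := hconv.out (mem_preimage.2 ((hline _).symm ▸ hfoot))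
    (mem_preimage.2 ((hline _).symm ▸ hend)) hz
  rwa [mem_preimage, hline] at this

theorem eqOn_transport (h : IsInflow m b) (hG : EqOn G G' (Icc 0 1)) (hS : EqOn S S' triangle) :
    EqOn (transport m b μ G S) (transport m b μ G' S') triangle := fun p hp => by
  have hint : charIntegral m b S p = charIntegral m b S' p :=
    intervalIntegral.integral_congr fun z hz =>
      hS (h.line_mem hp (by rwa [uIcc_of_le (h.foot_mem p hp).2] at hz))
  rw [transport, transport, hG (h.foot_mem_Icc hp), hint]

theorem eqOn_recover {β : ℝ → ℝ} {u u' v v' : ℝ × ℝ → ℝ} (hu : EqOn u u' triangle)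
    (hv : EqOn v v' triangle) : EqOn (recover μ β u v) (recover μ β u' v') triangle :=
  fun p hp => by
    have hint : ∫ z in p.2..p.1, (v (z, p.2) + u (z, p.2)) =
        ∫ z in p.2..p.1, (v' (z, p.2) + u' (z, p.2)) :=
      intervalIntegral.integral_congr fun z hz => by
        rw [uIcc_of_le hp.2.1] at hz
        have hz' := horizontal_mem_triangle hp hz
        simp only [hu hz', hv hz']
    rw [recover, recover, hint]

theorem abs_integral_sub_le_exp {f g : ℝ → ℝ} (hf : Continuous f) (hg : Continuous g)
    {M κ α x : ℝ} (hM : 0 ≤ M) (hκ : 0 < κ) (hα : α ≤ x)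
    (h : ∀ z ∈ Icc α x, |f z - g z| ≤ M * Real.exp (κ * z)) :
    |(∫ z in α..x, f z) - ∫ z in α..x, g z| ≤ M / κ * Real.exp (κ * x) := by
  rw [← intervalIntegral.integral_sub (hf.intervalIntegrable _ _) (hg.intervalIntegrable _ _)]
  refine (intervalIntegral.norm_integral_le_of_norm_le (μ := volume)
    (f := fun z => f z - g z) (g := fun z => M * Real.exp (κ * z)) hα
    (Eventually.of_forall fun z hz => h z (Ioc_subset_Icc_self hz))
    (Continuous.intervalIntegrable (by fun_prop) _ _)).trans ?_
  rw [intervalIntegral.integral_const_mul, intervalIntegral.integral_comp_mul_left _ hκ.ne',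
    integral_exp, smul_eq_mul, div_eq_mul_inv, mul_assoc]
  have := Real.exp_pos (κ * α)
  gcongr
  linarith

theorem abs_transport_sub_le {M B κ : ℝ} (h : IsInflow m b) (hμ : 0 < μ)
    (hS : Continuous S) (hS' : Continuous S') (hM : 0 ≤ M) (hB : 0 ≤ B) (hκ : 0 < κ)
    (hG : ∀ x ∈ Icc (0 : ℝ) 1, |G x - G' x| ≤ B * Real.exp (κ * x))
    (hSS' : ∀ q ∈ triangle, |S q - S' q| ≤ M * Real.exp (κ * q.1)) (hp : p ∈ triangle) :
    |transport m b μ G S p - transport m b μ G' S' p| ≤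
      (B + M / (μ * κ)) * Real.exp (κ * p.1) := by
  have hint : |charIntegral m b S p - charIntegral m b S' p| ≤ M / κ * Real.exp (κ * p.1) :=
    abs_integral_sub_le_exp (by fun_prop) (by fun_prop) hM hκ (h.foot_mem p hp).2
      fun z hz => hSS' _ (h.line_mem hp hz)
  have hfoot : |G (foot m b p) - G' (foot m b p)| ≤ B * Real.exp (κ * p.1) :=
    (hG _ (h.foot_mem_Icc hp)).trans (by gcongr; exact (h.foot_mem p hp).2)
  rw [transport, transport, add_sub_add_comm, ← mul_sub]
  refine (abs_add_le _ _).trans ?_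
  rw [abs_mul, abs_of_pos (one_div_pos.2 hμ)]
  calc _ ≤ B * Real.exp (κ * p.1) + 1 / μ * (M / κ * Real.exp (κ * p.1)) := by gcongr
    _ = _ := by field_simp

theorem dx_eq_fderiv {f : ℝ × ℝ → ℝ} (hf : Differentiable ℝ f) (hp : p ∈ triangle) :
    dx f p = fderiv ℝ f p (1, 0) := by
  rw [dx, fderivWithin_eq_fderiv (uniqueDiffOn_triangle p hp) (hf p)]

theorem dy_eq_fderiv {f : ℝ × ℝ → ℝ} (hf : Differentiable ℝ f) (hp : p ∈ triangle) :
    dy f p = fderiv ℝ f p (0, 1) := by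
  rw [dy, fderivWithin_eq_fderiv (uniqueDiffOn_triangle p hp) (hf p)]

theorem dx_congr {f g : ℝ × ℝ → ℝ} (h : EqOn f g triangle) (hp : p ∈ triangle) :
    dx f p = dx g p := by
  rw [dx, dx, fderivWithin_congr' h hp]

theorem dy_congr {f g : ℝ × ℝ → ℝ} (h : EqOn f g triangle) (hp : p ∈ triangle) :
    dy f p = dy g p := by
  rw [dy, dy, fderivWithin_congr' h hp]

theorem dx_add_mul_dy (f : ℝ × ℝ → ℝ) (p : ℝ × ℝ) (m : ℝ) :
    dx f p + m * dy f p = fderivWithin ℝ f triangle p (1, m) := by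
  have : ((1, m) : ℝ × ℝ) = (1, 0) + m • (0, 1) := by simp
  rw [this, map_add, map_smul]
  rfl

theorem integral_along_line {f : ℝ × ℝ → ℝ} (hf : ContDiffOn ℝ 1 f triangle) {w l x : ℝ}
    (hlx : l ≤ x) (hmem : ∀ z ∈ Icc l x, (z, w + m * z) ∈ triangle) {g : ℝ → ℝ} (hg : Continuous g)
    (hd : ∀ z ∈ Icc l x, dx f (z, w + m * z) + m * dy f (z, w + m * z) = g z) :
    ∫ z in l..x, g z = f (x, w + m * x) - f (l, w + m * l) := by
  refine intervalIntegral.integral_eq_sub_of_hasDerivAt_of_le (f := fun z => f (z, w + m * z)) hlx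
    (hf.continuousOn.comp (by fun_prop) hmem) (fun z hz => ?_) (hg.intervalIntegrable _ _)
  have hz' := Ioo_subset_Icc_self hz
  have hf' := (hf.differentiableOn one_ne_zero _ (hmem z hz')).hasFDerivWithinAt
  have hline : HasDerivAt (fun z => (z, w + m * z)) (1, m) z := by
    refine (hasDerivAt_id z).prodMk ?_
    simpa using ((hasDerivAt_id z).const_mul m).const_add w
  refine ((hf'.comp_hasDerivWithinAt z hline.hasDerivWithinAt hmem).hasDerivAt
    (Icc_mem_nhds hz.1 hz.2)).congr_deriv ?_
  rw [← dx_add_mul_dy, hd z hz']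

theorem eqOn_transport_of_pde {f : ℝ × ℝ → ℝ} (h : IsInflow m b) (hμ : μ ≠ 0)
    (hf : ContDiffOn ℝ 1 f triangle) (hS : Continuous S)
    (hpde : ∀ p ∈ triangle, μ * (dx f p + m * dy f p) = S p) :
    EqOn f (transport m b μ (fun x => f (x, b * x)) S) triangle := fun p hp => by
  have key := integral_along_line hf (m := m) (w := p.2 - m * p.1) (h.foot_mem p hp).2
    (fun z hz => h.line_mem hp hz) (g := fun z => 1 / μ * S (z, p.2 - m * p.1 + m * z))
    (by fun_prop) (fun z hz => by rw [← hpde _ (h.line_mem hp hz)]; field_simp)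
  rw [intervalIntegral.integral_const_mul, base_foot h.ne, sub_add_cancel] at key
  rw [transport, charIntegral, key]
  ring

end Triangle

section WeightedContraction

variable {X ι : Type*} [TopologicalSpace X] [Finite ι] {T : Set X}
  {Φ : (ι → X → ℝ) → ι → X → ℝ} {w : ι → X → ℝ} {θ : ℝ}

/-- On families of continuous functions, `Φ` contracts by the factor `θ` the sup norm over `T`
in which the `i`-th component is divided by the weight `w i`. -/
structure IsWeightedContraction (T : Set X) (Φ : (ι → X → ℝ) → ι → X → ℝ) (w : ι → X → ℝ)
    (θ : ℝ) : Prop where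
  continuous_weight : ∀ i, Continuous (w i)
  weight_pos : ∀ i x, 0 < w i x
  factor_nonneg : 0 ≤ θ
  factor_lt_one : θ < 1
  abs_sub_le : ∀ u v, (∀ i, Continuous (u i)) → (∀ i, Continuous (v i)) → ∀ D, 0 ≤ D →
    (∀ i, ∀ p ∈ T, |u i p - v i p| ≤ D * w i p) →
    ∀ i, ∀ p ∈ T, |Φ u i p - Φ v i p| ≤ θ * D * w i p

theorem IsWeightedContraction.exists_fixedPoint (h : IsWeightedContraction T Φ w θ)
    (hT : IsCompact T) {ρ : X → X} (hρ : Continuous ρ) (hρT : ∀ x, ρ x ∈ T)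
    (hρid : ∀ x ∈ T, ρ x = x)
    (hΦ : ∀ u, (∀ i, Continuous (u i)) → ∀ i, Continuous (Φ u i)) :
    ∃ u, (∀ i, Continuous (u i)) ∧ ∀ i, EqOn (u i) (Φ u i) T := by
  cases nonempty_fintype ι
  have : CompactSpace T := isCompact_iff_compactSpace.1 hT
  set ext : C(T, ι → ℝ) → ι → X → ℝ := fun v i x => w i x * v ⟨ρ x, hρT x⟩ i with hext
  have cext : ∀ v i, Continuous (ext v i) := fun v i => (h.continuous_weight i).mul
    ((continuous_apply i).comp (v.continuous.comp (hρ.subtype_mk hρT)))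
  set Ψ : C(T, ι → ℝ) → C(T, ι → ℝ) := fun v =>
    ⟨fun p i => Φ (ext v) i p / w i p, continuous_pi fun i =>
      ((hΦ _ (cext v) i).comp continuous_subtype_val).div
        ((h.continuous_weight i).comp continuous_subtype_val)
        fun p => (h.weight_pos i p).ne'⟩ with hΨ
  have hcontr : ContractingWith ⟨θ, h.factor_nonneg⟩ Ψ := by
    refine ⟨by exact_mod_cast h.factor_lt_one, LipschitzWith.of_dist_le_mul fun v v' => ?_⟩
    have hnonneg : 0 ≤ θ * dist v v' := mul_nonneg h.factor_nonneg dist_nonneg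
    refine (ContinuousMap.dist_le hnonneg).2 fun p => (dist_pi_le_iff hnonneg).2 fun i => ?_
    have hle := h.abs_sub_le (ext v) (ext v') (cext v) (cext v') (dist v v') dist_nonneg
      (fun i p _ => ?_) i p p.2
    · simp only [hΨ, ContinuousMap.coe_mk, Real.dist_eq]
      rw [← sub_div, abs_div, abs_of_pos (h.weight_pos i p), div_le_iff₀ (h.weight_pos i p)]
      exact hle
    · simp only [hext]
      rw [← mul_sub, abs_mul, abs_of_pos (h.weight_pos i p), mul_comm]
      refine mul_le_mul_of_nonneg_right ?_ (h.weight_pos i p).le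
      rw [← Real.dist_eq]
      exact (dist_le_pi_dist _ _ i).trans (ContinuousMap.dist_apply_le_dist _)
  set v := hcontr.fixedPoint Ψ
  refine ⟨ext v, cext v, fun i p hp => ?_⟩
  have hv : Φ (ext v) i p / w i p = v ⟨p, hp⟩ i :=
    congrFun (DFunLike.congr_fun hcontr.fixedPoint_isFixedPt (⟨p, hp⟩ : T)) i
  rw [div_eq_iff (h.weight_pos i p).ne'] at hv
  rw [hv, mul_comm]
  simp only [hext, hρid p hp]

theorem IsWeightedContraction.eqOn_of_fixedPoints (h : IsWeightedContraction T Φ w θ)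
    (hT : IsCompact T) {u v : ι → X → ℝ} (cu : ∀ i, Continuous (u i))
    (cv : ∀ i, Continuous (v i)) (hu : ∀ i, EqOn (u i) (Φ u i) T)
    (hv : ∀ i, EqOn (v i) (Φ v i) T) (i : ι) : EqOn (u i) (v i) T := by
  cases nonempty_fintype ι
  have hb : ∀ i, ∃ B, ∀ p ∈ T, |(u i p - v i p) / w i p| ≤ B := fun i =>
    hT.exists_bound_of_continuousOn (((cu i).sub (cv i)).div (h.continuous_weight i)
      fun p => (h.weight_pos i p).ne').continuousOn
  choose B hB using hb
  set D := ∑ j, |B j|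
  have hD : ∀ i, B i ≤ D := fun i => (le_abs_self _).trans
    (Finset.single_le_sum (f := fun j => |B j|) (fun j _ => abs_nonneg _) (Finset.mem_univ i))
  have : 0 ≤ D := Finset.sum_nonneg fun j _ => abs_nonneg _
  have hθ := h.factor_nonneg
  have hn : ∀ n : ℕ, ∀ i, ∀ p ∈ T, |u i p - v i p| ≤ θ ^ n * D * w i p := by
    intro n
    induction n with
    | zero =>
      intro i p hp
      have := (hB i p hp).trans (hD i)
      rw [abs_div, abs_of_pos (h.weight_pos i p), div_le_iff₀ (h.weight_pos i p)] at this
      rwa [pow_zero, one_mul]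
    | succ n ih =>
      intro i p hp
      rw [hu i hp, hv i hp, pow_succ', mul_assoc θ]
      exact h.abs_sub_le u v cu cv _ (by positivity) ih i p hp
  intro p hp
  have ht : Tendsto (fun n : ℕ => θ ^ n * D * w i p) atTop (𝓝 0) := by
    simpa using ((tendsto_pow_atTop_nhds_zero_of_lt_one hθ h.factor_lt_one).mul_const D).mul_const
      (w i p)
  exact sub_eq_zero.1 (abs_nonpos_iff.1 (ge_of_tendsto' ht fun n => hn n i p hp))

end WeightedContraction

section Dilation

variable {κ ρ : ℝ} {F G H : ℝ → ℝ}

theorem mul_mem_unitInterval (hρ : ρ ∈ Icc (0 : ℝ) 1) {x : ℝ} (hx : x ∈ Icc (0 : ℝ) 1) :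
    ρ * x ∈ Icc (0 : ℝ) 1 :=
  ⟨mul_nonneg hρ.1 hx.1, mul_le_one₀ hρ.2 hx.1 hx.2⟩

theorem isWeightedContraction_dilation (hκ : |κ| < 1) (hρ : ρ ∈ Icc (0 : ℝ) 1) (F : ℝ → ℝ) :
    IsWeightedContraction (Icc 0 1) (fun (u : Unit → ℝ → ℝ) i x => κ * u i (ρ * x) + F x)
      (fun _ _ => 1) |κ| where
  continuous_weight _ := continuous_const
  weight_pos _ _ := one_pos
  factor_nonneg := abs_nonneg κ
  factor_lt_one := hκ
  abs_sub_le u v _ _ D _ h i x hx := by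
    rw [add_sub_add_right_eq_sub, ← mul_sub, abs_mul, mul_assoc]
    exact mul_le_mul_of_nonneg_left (h i _ (mul_mem_unitInterval hρ hx)) (abs_nonneg κ)

theorem exists_continuous_of_dilation_eq (hκ : |κ| < 1) (hρ : ρ ∈ Icc (0 : ℝ) 1)
    (hF : Continuous F) :
    ∃ H : ℝ → ℝ, Continuous H ∧ ∀ x ∈ Icc (0 : ℝ) 1, H x = κ * H (ρ * x) + F x := by
  obtain ⟨u, cu, hu⟩ := (isWeightedContraction_dilation hκ hρ F).exists_fixedPoint isCompact_Icc
    continuous_clamp clamp_mem (fun x hx => clamp_of_mem hx) fun u hu i => by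
      have := hu i
      fun_prop
  exact ⟨u (), cu (), hu ()⟩

theorem eqOn_of_dilation_eq (hκ : |κ| < 1) (hρ : ρ ∈ Icc (0 : ℝ) 1) (cG : Continuous G)
    (cH : Continuous H) (hG : ∀ x ∈ Icc (0 : ℝ) 1, G x = κ * G (ρ * x) + F x)
    (hH : ∀ x ∈ Icc (0 : ℝ) 1, H x = κ * H (ρ * x) + F x) : EqOn G H (Icc 0 1) :=
  (isWeightedContraction_dilation hκ hρ F).eqOn_of_fixedPoints isCompact_Icc
    (u := fun _ => G) (v := fun _ => H) (fun _ => cG) (fun _ => cH) (fun _ => hG) (fun _ => hH) ()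

-- The derivative must solve the dilation equation with factor `κ ρ` and right-hand side `F'`, so
-- the solution is obtained by integrating the continuous solution of that equation.
theorem exists_contDiff_of_dilation_eq (hκ : |κ| < 1) (hρ : ρ ∈ Icc (0 : ℝ) 1)
    (hF : ContDiff ℝ 1 F) (hH : Continuous H)
    (h : ∀ x ∈ Icc (0 : ℝ) 1, H x = κ * H (ρ * x) + F x) :
    ∃ G : ℝ → ℝ, ContDiff ℝ 1 G ∧ EqOn G H (Icc 0 1) := by
  have cF : Continuous (deriv F) := hF.continuous_deriv le_rfl
  have hκρ : |κ * ρ| < 1 := by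
    rw [abs_mul, abs_of_nonneg hρ.1]
    exact mul_lt_one_of_nonneg_of_lt_one_left (abs_nonneg κ) hκ hρ.2
  obtain ⟨D, cD, hD⟩ := exists_continuous_of_dilation_eq hκρ hρ cF
  have cG : ContDiff ℝ 1 fun x => H 0 + ∫ t in (0 : ℝ)..x, D t :=
    contDiff_const.add (by simpa using contDiff_primitive (n := 0) (contDiff_zero.2 cD))
  refine ⟨_, cG, eqOn_of_dilation_eq hκ hρ cG.continuous hH (fun x hx => ?_) h⟩
  have hint : ∫ t in (0 : ℝ)..x, D t =
      ∫ t in (0 : ℝ)..x, (ρ * (κ * D (ρ * t)) + deriv F t) :=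
    intervalIntegral.integral_congr fun t ht => by
      rw [uIcc_of_le hx.1] at ht
      simp only [hD t ⟨ht.1, ht.2.trans hx.2⟩, mul_assoc, mul_left_comm κ]
  have hdilate : ∫ t in (0 : ℝ)..x, ρ * (κ * D (ρ * t)) = κ * ∫ t in (0 : ℝ)..(ρ * x), D t := by
    rw [intervalIntegral.integral_const_mul,
      intervalIntegral.mul_integral_comp_mul_left (f := fun t => κ * D t), mul_zero,
      intervalIntegral.integral_const_mul]
  have hderiv : ∫ t in (0 : ℝ)..x, deriv F t = F x - F 0 :=
    intervalIntegral.integral_deriv_eq_sub (fun t _ => hF.differentiable one_ne_zero t)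
      (cF.intervalIntegrable _ _)
  have h0 := h 0 (by simp)
  rw [mul_zero] at h0
  rw [hint, intervalIntegral.integral_add (Continuous.intervalIntegrable (by fun_prop) _ _)
    (cF.intervalIntegrable _ _), hdilate, hderiv]
  linarith

end Dilation

/-- The four unknowns of the second-row kernel system: `hat j` and `check j` are the Riemann
invariants `k̂₂ᵢ` and `ǩ₂ᵢ` with `i = j + 1`. -/
inductive Invariant
  | hat (j : Fin 2)
  | check (j : Fin 2)

namespace Invariant

instance : Finite Invariant :=
  .of_surjective (Sum.elim hat check) (by rintro (j | j); exacts [⟨.inl j, rfl⟩, ⟨.inr j, rfl⟩])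

/-- The state a Riemann invariant belongs to. -/
def state : Invariant → Fin 2
  | hat j => j
  | check j => j

/-- The slope `b` of the edge `y = b x` of the triangle on which an invariant is prescribed. -/
def base : Invariant → ℝ
  | hat _ => 0
  | check _ => 1

end Invariant

open Invariant

/-- The coefficients of the second-row kernel system, normalized by `μ = √ε₂`, `μ / a = √ε₁` and
`L j = λᵢ + c₂`, `k j = k₁ᵢ` with `i = j + 1`; `γ` is the factor in `g[k₂₁]`. The functions are
extended continuously off `[0, 1]` and off the triangle. -/
structure Coefficients where
  a : ℝ
  μ : ℝ
  γ : ℝ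
  L : Fin 2 → ℝ → ℝ
  k : Fin 2 → ℝ × ℝ → ℝ
  a_pos : 0 < a
  a_le_one : a ≤ 1
  μ_pos : 0 < μ
  continuous_L : ∀ j, Continuous (L j)
  continuous_k : ∀ j, Continuous (k j)

namespace Coefficients

variable (d : Coefficients) {u v : Invariant → ℝ × ℝ → ℝ}

/-- The characteristic slope `√εᵢ / √ε₂` of the `j`-th state, `i = j + 1`. -/
def speed : Fin 2 → ℝ := ![d.a⁻¹, 1]

/-- The slope of the characteristics of an invariant. -/
def slope : Invariant → ℝ
  | hat j => d.speed j
  | check j => -d.speed j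

/-- The reflection coefficient at the diagonal. -/
def r : ℝ := (1 - d.a) / (1 + d.a)

/-- The reflection coefficient at the axis. -/
def q : ℝ := (1 - d.a ^ 2) / (1 + d.a ^ 2)

/-- The transmission coefficient at the axis from the second to the first state. -/
def t₁ : ℝ := 2 * d.a ^ 3 / (1 + d.a ^ 2)

/-- The transmission coefficient at the axis from the first to the second state. -/
def t₂ : ℝ := 2 / (d.a * (1 + d.a ^ 2))

/-- The derivative of `x ↦ k₂ᵢ(x, x)`, `i = j + 1`. -/
def diagonalRate : Fin 2 → ℝ → ℝ := ![0, fun x => -(d.L 1 x / (2 * d.μ ^ 2))]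

/-- The kernel `k₂ᵢ`, `i = j + 1`, as a function of the invariants. -/
def kernel (u : Invariant → ℝ × ℝ → ℝ) (j : Fin 2) : ℝ × ℝ → ℝ :=
  recover d.μ (d.diagonalRate j) (u (hat j)) (u (check j))

/-- The right-hand side of the two equations of the `j`-th state. -/
def source (u : Invariant → ℝ × ℝ → ℝ) (j : Fin 2) (p : ℝ × ℝ) : ℝ :=
  d.L j p.2 * d.kernel u j p -
    d.γ * (u (check 0) (p.1, p.1) - u (hat 0) (p.1, p.1)) * d.k j p

/-- The value which the boundary conditions prescribe for an invariant at `(x, b x)`, where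
`y = b x` is its base edge. -/
def trace (u : Invariant → ℝ × ℝ → ℝ) : Invariant → ℝ → ℝ
  | hat 0 => fun x => -d.q * u (check 0) (x, 0) + d.t₁ * u (check 1) (x, 0)
  | hat 1 => fun x => d.t₂ * u (check 0) (x, 0) + d.q * u (check 1) (x, 0)
  | check 0 => fun x => -d.r * u (hat 0) (x, x)
  | check 1 => fun x => -(d.L 1 x / (2 * d.μ))

/-- The invariants transported along their characteristics from the boundary values `G`, with the
sources `S` of the two states. -/
def propagate (G : Invariant → ℝ → ℝ) (S : Fin 2 → ℝ × ℝ → ℝ) (i : Invariant) : ℝ × ℝ → ℝ :=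
  transport (d.slope i) i.base d.μ (G i) (S i.state)

/-- The integration of the system along its characteristics. -/
def picard (u : Invariant → ℝ × ℝ → ℝ) : Invariant → ℝ × ℝ → ℝ :=
  d.propagate (d.trace u) (d.source u)

/-- A mild solution: a continuous solution of the system integrated along characteristics. -/
structure IsMild (u : Invariant → ℝ × ℝ → ℝ) : Prop where
  continuous : ∀ i, Continuous (u i)
  eqOn_picard : ∀ i, EqOn (u i) (d.picard u i) triangle

theorem one_le_speed (j : Fin 2) : 1 ≤ d.speed j := by
  fin_cases j
  exacts [(one_le_inv₀ d.a_pos).2 d.a_le_one, le_rfl]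

theorem speed_pos (j : Fin 2) : 0 < d.speed j := one_pos.trans_le (d.one_le_speed j)

theorem isInflow : ∀ i : Invariant, IsInflow (d.slope i) i.base
  | hat j => isInflow_axis (d.one_le_speed j)
  | check j => isInflow_diagonal (neg_neg_of_pos (d.speed_pos j))

theorem continuous_diagonalRate (j : Fin 2) : Continuous (d.diagonalRate j) := by
  fin_cases j
  exacts [continuous_const, ((d.continuous_L 1).div_const _).neg]

theorem continuous_kernel (hu : ∀ i, Continuous (u i)) (j : Fin 2) : Continuous (d.kernel u j) :=
  continuous_recover (d.continuous_diagonalRate j) (hu _) (hu _)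

theorem continuous_source (hu : ∀ i, Continuous (u i)) (j : Fin 2) : Continuous (d.source u j) := by
  have := d.continuous_L j
  have := d.continuous_k j
  have := d.continuous_kernel hu j
  have := hu (check 0)
  have := hu (hat 0)
  unfold source
  fun_prop

theorem continuous_trace (hu : ∀ i, Continuous (u i)) (i : Invariant) :
    Continuous (d.trace u i) := by
  have := d.continuous_L 1
  have := hu (check 0)
  have := hu (check 1)
  have := hu (hat 0)
  match i with
  | hat 0 | hat 1 | check 0 | check 1 => unfold trace; fun_prop

theorem continuous_propagate {G : Invariant → ℝ → ℝ} {S : Fin 2 → ℝ × ℝ → ℝ}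
    (hG : ∀ i, Continuous (G i)) (hS : ∀ j, Continuous (S j)) (i : Invariant) :
    Continuous (d.propagate G S i) :=
  continuous_transport (hG i) (hS i.state)

theorem continuous_picard (hu : ∀ i, Continuous (u i)) (i : Invariant) :
    Continuous (d.picard u i) :=
  d.continuous_propagate (d.continuous_trace hu) (d.continuous_source hu) i

theorem propagate_base (G : Invariant → ℝ → ℝ) (S : Fin 2 → ℝ × ℝ → ℝ) (i : Invariant) (x : ℝ) :
    d.propagate G S i (x, i.base * x) = G i x :=
  transport_base (d.isInflow i).ne x

section Contraction

theorem r_nonneg : 0 ≤ d.r := by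
  have := d.a_pos
  exact div_nonneg (by linarith [d.a_le_one]) (by positivity)

theorem r_lt_one : d.r < 1 := by
  have := d.a_pos
  rw [r, div_lt_one (by positivity)]
  linarith

theorem q_nonneg : 0 ≤ d.q :=
  div_nonneg (sub_nonneg.2 (pow_le_one₀ d.a_pos.le d.a_le_one)) (by positivity)

theorem q_lt_one : d.q < 1 := by
  have := pow_pos d.a_pos 2
  rw [q, div_lt_one (by positivity)]
  linarith

theorem t₁_nonneg : 0 ≤ d.t₁ := by
  have := d.a_pos
  unfold t₁
  positivity

theorem t₂_nonneg : 0 ≤ d.t₂ := by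
  have := d.a_pos
  unfold t₂
  positivity

theorem q_add_half_t₁_lt_one : d.q + d.t₁ / 2 < 1 := by
  have hsq : 0 < d.a ^ 2 := pow_pos d.a_pos 2
  have hcube : d.a ^ 3 ≤ d.a ^ 2 := pow_le_pow_of_le_one d.a_pos.le d.a_le_one (by norm_num)
  have h : d.q + d.t₁ / 2 = (1 - d.a ^ 2 + d.a ^ 3) / (1 + d.a ^ 2) := by
    unfold q t₁
    field_simp
  rw [h, div_lt_one (by positivity)]
  linarith

/-- Relative weights of the invariants in which the reflections at the boundary contract. -/
def ratio : Invariant → ℝ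
  | hat j => ![1, d.t₂ + 1] j
  | check j => ![1, 1 / 2] j

/-- The factor by which the reflections contract in the weights `ratio`. -/
def reflectionFactor : ℝ := max (d.q + d.t₁ / 2) (max ((d.t₂ + d.q / 2) / (d.t₂ + 1)) d.r)

/-- The weight, exponential in `x`, for which `picard` contracts. -/
def weight (κ : ℝ) (i : Invariant) (p : ℝ × ℝ) : ℝ := d.ratio i * Real.exp (κ * p.1)

theorem half_le_ratio (i : Invariant) : 1 / 2 ≤ d.ratio i := by
  have := d.t₂_nonneg
  match i with
  | hat 0 | hat 1 | check 0 | check 1 =>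
    simp only [ratio, Matrix.cons_val_zero, Matrix.cons_val_one]
    linarith

theorem ratio_le (i : Invariant) : d.ratio i ≤ d.t₂ + 1 := by
  have := d.t₂_nonneg
  match i with
  | hat 0 | hat 1 | check 0 | check 1 =>
    simp only [ratio, Matrix.cons_val_zero, Matrix.cons_val_one]
    linarith

theorem ratio_pos (i : Invariant) : 0 < d.ratio i := one_half_pos.trans_le (d.half_le_ratio i)

theorem reflectionFactor_nonneg : 0 ≤ d.reflectionFactor :=
  le_max_of_le_right (le_max_of_le_right d.r_nonneg)

theorem reflectionFactor_lt_one : d.reflectionFactor < 1 := by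
  have := d.t₂_nonneg
  refine max_lt d.q_add_half_t₁_lt_one (max_lt ?_ d.r_lt_one)
  rw [div_lt_one (by positivity)]
  linarith [d.q_lt_one]

theorem abs_trace_sub_le {x E : ℝ} (hx : 0 ≤ x) (hE : 0 ≤ E)
    (h : ∀ i, ∀ y ∈ Icc 0 x, |u i (x, y) - v i (x, y)| ≤ d.ratio i * E) (i : Invariant) :
    |d.trace u i x - d.trace v i x| ≤ d.reflectionFactor * (d.ratio i * E) := by
  have hc : ∀ j, |u (check j) (x, 0) - v (check j) (x, 0)| ≤ ![1, 1 / 2] j * E :=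
    fun j => h (check j) 0 (left_mem_Icc.2 hx)
  have hh : |u (hat 0) (x, x) - v (hat 0) (x, x)| ≤ 1 * E := h (hat 0) x (right_mem_Icc.2 hx)
  have axis : ∀ {s t : ℝ}, |s * u (check 0) (x, 0) + t * u (check 1) (x, 0) -
      (s * v (check 0) (x, 0) + t * v (check 1) (x, 0))| ≤ (|s| + |t| / 2) * E := fun {s t} => by
    rw [add_sub_add_comm, ← mul_sub, ← mul_sub]
    refine (abs_add_le _ _).trans ?_
    rw [abs_mul, abs_mul]
    calc _ ≤ |s| * (1 * E) + |t| * (1 / 2 * E) := by gcongr; exacts [hc 0, hc 1]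
      _ = _ := by ring
  have ht := d.t₂_nonneg
  match i with
  | hat 0 =>
    refine axis.trans ?_
    rw [abs_neg, abs_of_nonneg d.q_nonneg, abs_of_nonneg d.t₁_nonneg, ratio,
      Matrix.cons_val_zero, one_mul]
    exact mul_le_mul_of_nonneg_right (le_max_left _ _) hE
  | hat 1 =>
    refine axis.trans ?_
    rw [abs_of_nonneg d.q_nonneg, abs_of_nonneg ht, ← mul_assoc]
    refine mul_le_mul_of_nonneg_right ((div_le_iff₀ (d.ratio_pos _)).1 ?_) hE
    exact le_max_of_le_right (le_max_left _ _)
  | check 0 =>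
    simp only [trace, ratio, Matrix.cons_val_zero]
    rw [← mul_sub, abs_mul, abs_neg, abs_of_nonneg d.r_nonneg]
    exact mul_le_mul (le_max_of_le_right (le_max_right _ _)) hh (abs_nonneg _)
      d.reflectionFactor_nonneg
  | check 1 =>
    simp only [trace, sub_self, abs_zero]
    exact mul_nonneg d.reflectionFactor_nonneg (mul_nonneg (d.ratio_pos _).le hE)

theorem abs_kernel_sub_le {M κ : ℝ} (hu : ∀ i, Continuous (u i)) (hv : ∀ i, Continuous (v i))
    (hM : 0 ≤ M) (hκ : 1 ≤ κ)
    (h : ∀ i, ∀ p ∈ triangle, |u i p - v i p| ≤ M * Real.exp (κ * p.1)) (j : Fin 2) {p : ℝ × ℝ}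
    (hp : p ∈ triangle) :
    |d.kernel u j p - d.kernel v j p| ≤ M / d.μ * Real.exp (κ * p.1) := by
  have hμ := d.μ_pos
  have hint := abs_integral_sub_le_exp (M := 2 * M) (κ := κ)
    (f := fun z => u (check j) (z, p.2) + u (hat j) (z, p.2))
    (g := fun z => v (check j) (z, p.2) + v (hat j) (z, p.2))
    (by have := hu (check j); have := hu (hat j); fun_prop)
    (by have := hv (check j); have := hv (hat j); fun_prop)
    (by positivity) (by linarith) hp.2.1 fun z hz => by
      have hz' := horizontal_mem_triangle hp hz
      rw [add_sub_add_comm, two_mul, add_mul]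
      exact (abs_add_le _ _).trans (add_le_add (h _ _ hz') (h _ _ hz'))
  rw [kernel, kernel, recover, recover, add_sub_add_left_eq_sub, ← mul_sub, abs_mul,
    abs_of_pos (by positivity)]
  calc _ ≤ 1 / (2 * d.μ) * (2 * M / κ * Real.exp (κ * p.1)) := by gcongr
    _ ≤ 1 / (2 * d.μ) * (2 * M * Real.exp (κ * p.1)) := by
      gcongr
      exact div_le_self (by positivity) hκ
    _ = _ := by field_simp

theorem exists_abs_source_sub_le (j : Fin 2) : ∃ N : ℝ, 0 ≤ N ∧
    ∀ u v : Invariant → ℝ × ℝ → ℝ, (∀ i, Continuous (u i)) → (∀ i, Continuous (v i)) →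
    ∀ κ, 1 ≤ κ → ∀ M, 0 ≤ M →
    (∀ i, ∀ p ∈ triangle, |u i p - v i p| ≤ M * Real.exp (κ * p.1)) → ∀ p ∈ triangle,
      |d.source u j p - d.source v j p| ≤ N * M * Real.exp (κ * p.1) := by
  obtain ⟨A, hA⟩ := isCompact_Icc.exists_bound_of_continuousOn (s := Icc (0 : ℝ) 1)
    (d.continuous_L j).continuousOn
  obtain ⟨B, hB⟩ := isCompact_triangle.exists_bound_of_continuousOn (d.continuous_k j).continuousOn
  have hμ := d.μ_pos
  have hA0 : 0 ≤ A := (norm_nonneg _).trans (hA 0 (by simp))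
  have hB0 : 0 ≤ B := (norm_nonneg _).trans (hB 0 (by simp [triangle]))
  refine ⟨A / d.μ + |d.γ| * 2 * B, by positivity, fun u v hu hv κ hκ M hM h p hp => ?_⟩
  have hdiag := diagonal_mem_triangle (fst_mem_of_mem_triangle hp)
  set E := Real.exp (κ * p.1)
  set δu := u (check 0) (p.1, p.1) - u (hat 0) (p.1, p.1)
  set δv := v (check 0) (p.1, p.1) - v (hat 0) (p.1, p.1)
  have hδ : |δu - δv| ≤ 2 * (M * E) := by
    rw [sub_sub_sub_comm, two_mul]
    exact (abs_sub _ _).trans (add_le_add (h _ _ hdiag) (h _ _ hdiag))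
  have hsplit : d.source u j p - d.source v j p =
      d.L j p.2 * (d.kernel u j p - d.kernel v j p) - d.γ * (δu - δv) * d.k j p := by
    simp only [source]
    ring
  rw [hsplit]
  refine (abs_sub _ _).trans ?_
  rw [abs_mul, abs_mul, abs_mul]
  calc _ ≤ A * (M / d.μ * E) + |d.γ| * (2 * (M * E)) * B := by
        gcongr
        exacts [hA _ (snd_mem_of_mem_triangle hp), d.abs_kernel_sub_le hu hv hM hκ h j hp, hB p hp]
    _ = _ := by ring

theorem exists_abs_picard_sub_le (i : Invariant) : ∃ N : ℝ, 0 ≤ N ∧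
    ∀ u v : Invariant → ℝ × ℝ → ℝ, (∀ i, Continuous (u i)) → (∀ i, Continuous (v i)) →
    ∀ κ, 1 ≤ κ → ∀ D, 0 ≤ D →
    (∀ i, ∀ p ∈ triangle, |u i p - v i p| ≤ D * d.weight κ i p) → ∀ p ∈ triangle,
      |d.picard u i p - d.picard v i p| ≤ (d.reflectionFactor + N / κ) * D * d.weight κ i p := by
  obtain ⟨N, hN, hsource⟩ := d.exists_abs_source_sub_le i.state
  have hμ := d.μ_pos
  have ht := d.t₂_nonneg
  have hθ := d.reflectionFactor_nonneg
  have hratio := d.half_le_ratio i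
  refine ⟨2 * N * (d.t₂ + 1) / d.μ, by positivity, fun u v hu hv κ hκ D hD h p hp => ?_⟩
  have htrace : ∀ x ∈ Icc (0 : ℝ) 1, |d.trace u i x - d.trace v i x| ≤
      d.reflectionFactor * (D * d.ratio i) * Real.exp (κ * x) := fun x hx => by
    refine (d.abs_trace_sub_le hx.1 (by positivity : 0 ≤ D * Real.exp (κ * x))
      (fun i y hy => (h i (x, y) ⟨hy.1, hy.2, hx.2⟩).trans_eq ?_) i).trans_eq ?_
    · simp only [weight]
      ring
    · ring
  have hsrc := hsource u v hu hv κ hκ (D * (d.t₂ + 1)) (by positivity)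
    fun i p hp => (h i p hp).trans <| by
      rw [weight, ← mul_assoc]
      gcongr
      exact d.ratio_le i
  refine (abs_transport_sub_le (d.isInflow i) hμ (d.continuous_source hu _)
    (d.continuous_source hv _) (by positivity) (by positivity) (by positivity)
    htrace hsrc hp).trans ?_
  rw [weight, ← mul_assoc (_ * D)]
  refine mul_le_mul_of_nonneg_right ?_ (Real.exp_pos _).le
  calc d.reflectionFactor * (D * d.ratio i) + N * (D * (d.t₂ + 1)) / (d.μ * κ)
      = d.reflectionFactor * D * d.ratio i +
        2 * N * (d.t₂ + 1) / d.μ / κ * D * (1 / 2) := by field_simp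
    _ ≤ d.reflectionFactor * D * d.ratio i +
        2 * N * (d.t₂ + 1) / d.μ / κ * D * d.ratio i := by gcongr
    _ = _ := by ring

theorem exists_isWeightedContraction_picard :
    ∃ κ θ, IsWeightedContraction triangle d.picard (d.weight κ) θ := by
  choose N hN hpicard using d.exists_abs_picard_sub_le
  obtain ⟨A, hA⟩ := (finite_range N).bddAbove
  have hNA : ∀ i, N i ≤ A := fun i => hA ⟨i, rfl⟩
  have hA0 : 0 ≤ A := (hN (hat 0)).trans (hNA _)
  have hθ0 := d.reflectionFactor_nonneg
  have hη : 0 < (1 - d.reflectionFactor) / 2 := by linarith [d.reflectionFactor_lt_one]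
  set κ := A / ((1 - d.reflectionFactor) / 2) + 1
  have hκ : 1 ≤ κ := le_add_of_nonneg_left (by positivity)
  have hAκ : A / κ ≤ (1 - d.reflectionFactor) / 2 := by
    rw [div_le_iff₀ (by positivity), ← div_le_iff₀' hη]
    exact le_add_of_nonneg_right zero_le_one
  refine ⟨κ, d.reflectionFactor + A / κ, fun i => by unfold weight; fun_prop,
    fun i p => mul_pos (d.ratio_pos i) (Real.exp_pos _), by positivity, by linarith,
    fun u v hu hv D hD h i p hp => (hpicard i u v hu hv κ hκ D hD h p hp).trans ?_⟩
  have hw : 0 ≤ d.weight κ i p := mul_nonneg (d.ratio_pos i).le (Real.exp_pos _).le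
  gcongr
  exact hNA i

end Contraction

theorem exists_isMild : ∃ u, d.IsMild u := by
  obtain ⟨κ, θ, h⟩ := d.exists_isWeightedContraction_picard
  obtain ⟨u, hu, hpicard⟩ := h.exists_fixedPoint isCompact_triangle (continuous_sectorRetract 0 1)
    (fun p => triangle_eq_sector ▸ sectorRetract_mem zero_le_one p)
    (fun p hp => sectorRetract_of_mem (triangle_eq_sector ▸ hp)) fun u hu => d.continuous_picard hu
  exact ⟨u, hu, hpicard⟩

variable {d}

theorem IsMild.eqOn (hu : d.IsMild u) (hv : d.IsMild v) (i : Invariant) :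
    EqOn (u i) (v i) triangle := by
  obtain ⟨κ, θ, h⟩ := d.exists_isWeightedContraction_picard
  exact h.eqOn_of_fixedPoints isCompact_triangle hu.continuous hv.continuous hu.eqOn_picard
    hv.eqOn_picard i

variable (d) {G : Invariant → ℝ → ℝ} {S : Fin 2 → ℝ × ℝ → ℝ}

/-- The regularity of the coefficients under which the invariants are continuously
differentiable. -/
structure IsRegular : Prop where
  contDiff_L : ∀ j, ContDiff ℝ 1 (d.L j)
  regular_k : ∀ i, ∃ ky, RegularAlong (d.slope i) (d.k i.state) ky

theorem eqOn_kernel (h : ∀ i, EqOn (u i) (v i) triangle) (j : Fin 2) :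
    EqOn (d.kernel u j) (d.kernel v j) triangle :=
  eqOn_recover (h _) (h _)

theorem eqOn_source (h : ∀ i, EqOn (u i) (v i) triangle) (j : Fin 2) :
    EqOn (d.source u j) (d.source v j) triangle := fun p hp => by
  have hdiag := diagonal_mem_triangle (fst_mem_of_mem_triangle hp)
  simp only [source, d.eqOn_kernel h j hp, h _ hdiag]

theorem eqOn_trace (h : ∀ i, EqOn (u i) (v i) triangle) (i : Invariant) :
    EqOn (d.trace u i) (d.trace v i) (Icc 0 1) := fun x hx => by
  have haxis : (x, (0 : ℝ)) ∈ triangle := ⟨le_rfl, hx.1, hx.2⟩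
  have hdiag := diagonal_mem_triangle hx
  match i with
  | hat 0 | hat 1 => simp only [trace, h _ haxis]
  | check 0 => simp only [trace, h _ hdiag]
  | check 1 => rfl

theorem contDiff_trace (hL : ContDiff ℝ 1 (d.L 1)) (hu : ∀ i, ContDiff ℝ 1 (u i))
    (i : Invariant) : ContDiff ℝ 1 (d.trace u i) := by
  have := hu (check 0)
  have := hu (check 1)
  have := hu (hat 0)
  match i with
  | hat 0 | hat 1 | check 0 | check 1 => unfold trace; fun_prop

theorem contDiff_propagate (hG : ∀ i, ContDiff ℝ 1 (G i))
    (hS : ∀ i : Invariant, ∃ Sy, RegularAlong (d.slope i) (S i.state) Sy) (i : Invariant) :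
    ContDiff ℝ 1 (d.propagate G S i) :=
  (hS i).elim fun _ h => h.contDiff_transport (hG i)

theorem diagonalRate_eq_of_trace {x : ℝ} (h : ∀ j, v (check j) (x, x) = d.trace v (check j) x)
    (j : Fin 2) :
    v (hat j) (x, x) + v (check j) (x, x) +
      (d.speed j)⁻¹ * (v (check j) (x, x) - v (hat j) (x, x)) = 2 * d.μ * d.diagonalRate j x := by
  have ha : 1 + d.a ≠ 0 := by linarith [d.a_pos]
  have hμ := d.μ_pos.ne'
  rw [h j]
  match j with
  | 0 =>
    simp only [trace, speed, diagonalRate, r, Matrix.cons_val_zero, inv_inv, Pi.zero_apply]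
    field_simp
    ring
  | 1 =>
    simp only [trace, speed, diagonalRate, Matrix.cons_val_one, Matrix.cons_val_zero]
    field_simp
    ring

theorem exists_hasFDerivAt_kernel (hG : ∀ i, Continuous (G i)) (hS : ∀ j, Continuous (S j))
    (h : ∀ j, ∀ x ∈ Icc (0 : ℝ) 1, G (check j) x = d.trace (d.propagate G S) (check j) x)
    (j : Fin 2) : ∃ K, EqOn (d.kernel (d.propagate G S) j) K triangle ∧
      ∀ p, HasFDerivAt K (planeForm
        (1 / (2 * d.μ) * (d.propagate G S (hat j) p + d.propagate G S (check j) p))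
        (1 / (2 * d.μ) * ((d.speed j)⁻¹ *
          (d.propagate G S (check j) p - d.propagate G S (hat j) p)))) p := by
  set W := potential (d.speed j) d.μ (G (hat j)) (G (check j)) (S j)
  have hW : ∀ p, HasFDerivAt W (planeForm
      (d.propagate G S (hat j) p + d.propagate G S (check j) p) ((d.speed j)⁻¹ *
        (d.propagate G S (check j) p - d.propagate G S (hat j) p))) p :=
    hasFDerivAt_potential (d.speed_pos j) (hG _) (hG _) (hS j)
  refine ⟨fun p => 1 / (2 * d.μ) * (W p - W (0, 0)), fun p hp => ?_, fun p => ?_⟩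
  · refine recover_eq_of_potential d.μ_pos.ne' hW (d.continuous_propagate hG hS _)
      (d.continuous_propagate hG hS _) (fun t ht => d.diagonalRate_eq_of_trace (fun j => ?_) j) hp
    rw [← h j t ht, ← d.propagate_base G S (check j) t, base, one_mul]
  · refine (((hW p).sub_const _).const_mul _).congr_fderiv ?_
    ext <;> simp

variable {d}

theorem IsMild.exists_contDiff_kernel (hu : d.IsMild u) (j : Fin 2) :
    ∃ K, ContDiff ℝ 1 K ∧ EqOn (d.kernel u j) K triangle := by
  have hG := d.continuous_trace hu.continuous
  have hS := d.continuous_source hu.continuous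
  have hcont := d.continuous_propagate hG hS
  obtain ⟨K, hK, hderiv⟩ := d.exists_hasFDerivAt_kernel hG hS
    (fun j x hx => d.eqOn_trace hu.eqOn_picard (check j) hx) j
  refine ⟨K, ?_, (d.eqOn_kernel hu.eqOn_picard j).trans hK⟩
  have := contDiff_of_hasFDerivAt_planeForm (n := 0) hderiv
    (contDiff_zero.2 (by have := hcont (hat j); have := hcont (check j); fun_prop))
    (contDiff_zero.2 (by have := hcont (hat j); have := hcont (check j); fun_prop))
  simpa using this

theorem IsMild.exists_regular_source (hu : d.IsMild u) (hd : d.IsRegular) :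
    ∃ S : Fin 2 → ℝ × ℝ → ℝ, (∀ j, EqOn (d.source u j) (S j) triangle) ∧
      ∀ i : Invariant, ∃ Sy, RegularAlong (d.slope i) (S i.state) Sy := by
  choose K hK hKu using hu.exists_contDiff_kernel
  have hc := hu.continuous (check 0)
  have hh := hu.continuous (hat 0)
  refine ⟨fun j p => d.L j p.2 * K j p +
    -(d.γ * (u (check 0) (p.1, p.1) - u (hat 0) (p.1, p.1))) * d.k j p, fun j p hp => ?_,
    fun i => ?_⟩
  · simp only [source, hKu j hp]
    ring
  · obtain ⟨ky, hky⟩ := hd.regular_k i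
    have hLK : ContDiff ℝ 1 fun p : ℝ × ℝ => d.L i.state p.2 * K i.state p :=
      ((hd.contDiff_L _).comp contDiff_snd).mul (hK _)
    have htrace := RegularAlong.of_fst (m := d.slope i)
      (φ := fun x => -(d.γ * (u (check 0) (x, x) - u (hat 0) (x, x)))) (by fun_prop)
    exact ⟨_, (RegularAlong.of_contDiff hLK).add (htrace.mul hky)⟩

section Bootstrap

theorem IsMild.eqOn_propagate (hu : d.IsMild u) (hG : ∀ i, EqOn (d.trace u i) (G i) (Icc 0 1))
    (hS : ∀ j, EqOn (d.source u j) (S j) triangle) (i : Invariant) :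
    EqOn (u i) (d.propagate G S i) triangle :=
  (hu.eqOn_picard i).trans (eqOn_transport (d.isInflow i) (hG i) (hS _))

theorem IsMild.exists_contDiff_of_trace (hu : d.IsMild u)
    (hS : ∀ j, EqOn (d.source u j) (S j) triangle)
    (hreg : ∀ i : Invariant, ∃ Sy, RegularAlong (d.slope i) (S i.state) Sy) {i : Invariant}
    {g : ℝ → ℝ} (hg : ContDiff ℝ 1 g) (hgu : EqOn (d.trace u i) g (Icc 0 1)) :
    ∃ f, ContDiff ℝ 1 f ∧ EqOn (u i) f triangle :=
  (hreg i).elim fun _ h => ⟨_, h.contDiff_transport hg,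
    (hu.eqOn_picard i).trans (eqOn_transport (d.isInflow i) hgu (hS _))⟩

theorem foot_hat_foot_check (x : ℝ) :
    foot (d.slope (hat 0)) 0
      (foot (d.slope (check 0)) 1 (x, 0), foot (d.slope (check 0)) 1 (x, 0)) = d.r * x := by
  have ha := d.a_pos
  have hσ : foot (d.slope (check 0)) 1 (x, 0) = x / (1 + d.a) := by
    have : 1 + d.a⁻¹ ≠ 0 := by positivity
    simp only [foot, slope, speed, Matrix.cons_val_zero, sub_neg_eq_add]
    field_simp
    ring
  rw [hσ]
  simp only [foot, slope, speed, r, Matrix.cons_val_zero]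
  field_simp
  ring

/-- Follow a characteristic backwards from the axis to the diagonal and back to the axis: the trace
on the axis at `x` is `q r` times the trace at `r x`, up to a continuously differentiable term. -/
theorem IsMild.exists_contDiff_axis_trace (hu : d.IsMild u)
    (hS : ∀ j, EqOn (d.source u j) (S j) triangle)
    (hreg : ∀ i : Invariant, ∃ Sy, RegularAlong (d.slope i) (S i.state) Sy)
    {f : ℝ × ℝ → ℝ} (hf : ContDiff ℝ 1 f) (hfu : EqOn (u (check 1)) f triangle) :
    ∃ g, ContDiff ℝ 1 g ∧ EqOn (d.trace u (hat 0)) g (Icc 0 1) := by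
  set I : Invariant → ℝ × ℝ → ℝ := fun i p =>
    1 / d.μ * charIntegral (d.slope i) i.base (S i.state) p
  have hI : ∀ i, ContDiff ℝ 1 (I i) := fun i =>
    (hreg i).elim fun _ h => contDiff_const.mul h.contDiff_charIntegral
  have hu' := hu.eqOn_propagate (fun _ => eqOn_refl _ _) hS
  set σ : ℝ → ℝ := fun x => foot (d.slope (check 0)) 1 (x, 0)
  set F : ℝ → ℝ := fun x =>
    d.q * d.r * I (hat 0) (σ x, σ x) - d.q * I (check 0) (x, 0) + d.t₁ * f (x, 0)
  have hF : ContDiff ℝ 1 F := by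
    have hσ : ContDiff ℝ 1 σ := contDiff_foot.comp (contDiff_id.prodMk contDiff_const)
    have := hI (hat 0)
    have := hI (check 0)
    fun_prop
  have hdilation : ∀ x ∈ Icc (0 : ℝ) 1,
      d.trace u (hat 0) x = d.q * d.r * d.trace u (hat 0) (d.r * x) + F x := fun x hx => by
    have haxis : (x, (0 : ℝ)) ∈ triangle := ⟨le_rfl, hx.1, hx.2⟩
    have hdiag := diagonal_mem_triangle ((d.isInflow (check 0)).foot_mem_Icc haxis)
    have hcheck : u (check 0) (x, 0) = -d.r * u (hat 0) (σ x, σ x) + I (check 0) (x, 0) :=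
      hu' (check 0) haxis
    have hhat : u (hat 0) (σ x, σ x) = d.trace u (hat 0) (d.r * x) + I (hat 0) (σ x, σ x) := by
      rw [← foot_hat_foot_check]
      exact hu' (hat 0) hdiag
    have htrace : d.trace u (hat 0) x =
      -d.q * u (check 0) (x, 0) + d.t₁ * u (check 1) (x, 0) := rfl
    simp only [htrace, hcheck, hhat, hfu haxis, F]
    ring
  have hqr : |d.q * d.r| < 1 := by
    rw [abs_of_nonneg (mul_nonneg d.q_nonneg d.r_nonneg)]
    exact mul_lt_one_of_nonneg_of_lt_one_left d.q_nonneg d.q_lt_one d.r_lt_one.le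
  obtain ⟨g, hg, hgu⟩ := exists_contDiff_of_dilation_eq hqr ⟨d.r_nonneg, d.r_lt_one.le⟩ hF
    (d.continuous_trace hu.continuous (hat 0)) hdilation
  exact ⟨g, hg, hgu.symm⟩

theorem IsMild.exists_contDiff (hu : d.IsMild u) (hd : d.IsRegular)
    (hS : ∀ j, EqOn (d.source u j) (S j) triangle)
    (hreg : ∀ i : Invariant, ∃ Sy, RegularAlong (d.slope i) (S i.state) Sy) (i : Invariant) :
    ∃ f, ContDiff ℝ 1 f ∧ EqOn (u i) f triangle := by
  have haxis : ∀ x ∈ Icc (0 : ℝ) 1, (x, (0 : ℝ)) ∈ triangle := fun x hx => ⟨le_rfl, hx.1, hx.2⟩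
  obtain ⟨c₁, hc₁, hc₁u⟩ := hu.exists_contDiff_of_trace hS hreg (i := check 1)
    (((hd.contDiff_L 1).div_const (2 * d.μ)).neg) (fun _ _ => rfl)
  obtain ⟨g, hg, hgu⟩ := hu.exists_contDiff_axis_trace hS hreg hc₁ hc₁u
  obtain ⟨h₀, hh₀, hh₀u⟩ := hu.exists_contDiff_of_trace hS hreg hg hgu
  obtain ⟨c₀, hc₀, hc₀u⟩ := hu.exists_contDiff_of_trace hS hreg (i := check 0)
    (g := fun x => -d.r * h₀ (x, x)) (by fun_prop)
    fun x hx => congrArg (-d.r * ·) (hh₀u (diagonal_mem_triangle hx))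
  match i with
  | check 1 => exact ⟨c₁, hc₁, hc₁u⟩
  | hat 0 => exact ⟨h₀, hh₀, hh₀u⟩
  | check 0 => exact ⟨c₀, hc₀, hc₀u⟩
  | hat 1 =>
    refine hu.exists_contDiff_of_trace hS hreg (g := fun x => d.t₂ * c₀ (x, 0) + d.q * c₁ (x, 0))
      (by fun_prop) fun x hx => ?_
    simp only [trace, hc₀u (haxis x hx), hc₁u (haxis x hx)]

end Bootstrap

variable (d)

/-- A classical solution: a continuously differentiable solution of the system on the triangle. -/
structure IsClassical (v : Invariant → ℝ × ℝ → ℝ) : Prop where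
  contDiffOn : ∀ i, ContDiffOn ℝ 1 (v i) triangle
  pde : ∀ i, ∀ p ∈ triangle,
    d.μ * (dx (v i) p + d.slope i * dy (v i) p) = d.source v i.state p
  boundary : ∀ i, ∀ x ∈ Icc (0 : ℝ) 1, v i (x, i.base * x) = d.trace v i x

variable {d}

theorem IsClassical.exists_isMild (hv : d.IsClassical v) :
    ∃ u, d.IsMild u ∧ ∀ i, EqOn (v i) (u i) triangle := by
  set u : Invariant → ℝ × ℝ → ℝ := fun i p => v i (sectorRetract 0 1 p)
  have hvu : ∀ i, EqOn (v i) (u i) triangle := fun i p hp =>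
    congrArg (v i) (sectorRetract_of_mem (triangle_eq_sector ▸ hp)).symm
  have hu : ∀ i, Continuous (u i) := fun i =>
    (hv.contDiffOn i).continuousOn.comp_continuous (continuous_sectorRetract 0 1)
      fun p => triangle_eq_sector ▸ sectorRetract_mem zero_le_one p
  have hpde : ∀ i, EqOn (v i) (transport (d.slope i) i.base d.μ (fun x => v i (x, i.base * x))
      (d.source u i.state)) triangle := fun i =>
    eqOn_transport_of_pde (d.isInflow i) d.μ_pos.ne' (hv.contDiffOn i)
      (d.continuous_source hu i.state) fun p hp => by rw [hv.pde i p hp, d.eqOn_source hvu _ hp]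
  refine ⟨u, ⟨hu, fun i => (hvu i).symm.trans ((hpde i).trans ?_)⟩, hvu⟩
  exact eqOn_transport (d.isInflow i)
    (fun x hx => (hv.boundary i x hx).trans (d.eqOn_trace hvu i hx)) (eqOn_refl _ _)

theorem IsClassical.eqOn (hu : d.IsClassical u) (hv : d.IsClassical v) (i : Invariant) :
    EqOn (u i) (v i) triangle := by
  obtain ⟨u', hu', huu'⟩ := hu.exists_isMild
  obtain ⟨v', hv', hvv'⟩ := hv.exists_isMild
  exact (huu' i).trans ((hu'.eqOn hv' i).trans (hvv' i).symm)

theorem IsMild.exists_eqOn_propagate (hu : d.IsMild u) (hd : d.IsRegular) :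
    ∃ (G : Invariant → ℝ → ℝ) (S : Fin 2 → ℝ × ℝ → ℝ), (∀ i, ContDiff ℝ 1 (G i)) ∧
      (∀ i : Invariant, ∃ Sy, RegularAlong (d.slope i) (S i.state) Sy) ∧
      (∀ i, EqOn (d.trace u i) (G i) (Icc 0 1)) ∧ (∀ j, EqOn (d.source u j) (S j) triangle) ∧
      ∀ i, EqOn (u i) (d.propagate G S i) triangle := by
  obtain ⟨S, hS, hreg⟩ := hu.exists_regular_source hd
  choose f hf hfu using hu.exists_contDiff hd hS hreg
  have hG := d.eqOn_trace hfu
  exact ⟨d.trace f, S, d.contDiff_trace (hd.contDiff_L 1) hf, hreg, hG, hS, hu.eqOn_propagate hG hS⟩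

theorem IsMild.isClassical (hu : d.IsMild u) (hd : d.IsRegular) : d.IsClassical u := by
  obtain ⟨G, S, hG, hreg, -, hSu, huw⟩ := hu.exists_eqOn_propagate hd
  have hw := d.contDiff_propagate hG hreg
  refine ⟨fun i => (hw i).contDiffOn.congr (huw i), fun i p hp => ?_,
    fun i x hx => (hu.eqOn_picard i ((d.isInflow i).base_mem x hx)).trans
      (d.propagate_base _ _ i x)⟩
  obtain ⟨Sy, hSy⟩ := hreg i
  have hdiff := (hw i).differentiable one_ne_zero
  rw [dx_congr (huw i) hp, dy_congr (huw i) hp, dx_eq_fderiv hdiff hp, dy_eq_fderiv hdiff hp,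
    hSu _ hp]
  exact hSy.fderiv_transport (d.isInflow i).ne d.μ_pos.ne' (hG i) p

theorem IsMild.exists_contDiff_two_kernel (hu : d.IsMild u) (hd : d.IsRegular) (j : Fin 2) :
    ∃ K, ContDiff ℝ 2 K ∧ EqOn (d.kernel u j) K triangle ∧
      ∀ p ∈ triangle, HasFDerivAt K (planeForm
        (1 / (2 * d.μ) * (u (hat j) p + u (check j) p))
        (1 / (2 * d.μ) * ((d.speed j)⁻¹ * (u (check j) p - u (hat j) p)))) p := by
  obtain ⟨G, S, hG, hreg, hGu, -, huw⟩ := hu.exists_eqOn_propagate hd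
  have hw := d.contDiff_propagate hG hreg
  obtain ⟨K, hK, hderiv⟩ := d.exists_hasFDerivAt_kernel (fun i => (hG i).continuous)
    (fun j => (hreg (hat j)).elim fun _ h => h.cont)
    (fun j x hx => (hGu (check j) hx).symm.trans (d.eqOn_trace huw (check j) hx)) j
  refine ⟨K, ?_, (d.eqOn_kernel huw j).trans hK, fun p hp => ?_⟩
  · have := contDiff_of_hasFDerivAt_planeForm (n := 1) hderiv
      (by have := hw (hat j); have := hw (check j); fun_prop)
      (by have := hw (hat j); have := hw (check j); fun_prop)
    simpa [one_add_one_eq_two] using this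
  · rw [huw _ hp, huw _ hp]
    exact hderiv p

theorem IsMild.contDiffOn_kernel (hu : d.IsMild u) (hd : d.IsRegular) (j : Fin 2) :
    ContDiffOn ℝ 2 (d.kernel u j) triangle := by
  obtain ⟨K, hK, hKu, -⟩ := hu.exists_contDiff_two_kernel hd j
  exact hK.contDiffOn.congr hKu

theorem IsMild.eq_dx_kernel (hu : d.IsMild u) (hd : d.IsRegular) (j : Fin 2) {p : ℝ × ℝ}
    (hp : p ∈ triangle) :
    u (hat j) p = d.μ * dx (d.kernel u j) p - d.μ * d.speed j * dy (d.kernel u j) p ∧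
      u (check j) p = d.μ * dx (d.kernel u j) p + d.μ * d.speed j * dy (d.kernel u j) p := by
  obtain ⟨K, hK, hKu, hderiv⟩ := hu.exists_contDiff_two_kernel hd j
  have hdiff := hK.differentiable two_ne_zero
  have hμ := d.μ_pos.ne'
  have hs := (d.speed_pos j).ne'
  rw [dx_congr hKu hp, dy_congr hKu hp, dx_eq_fderiv hdiff hp, dy_eq_fderiv hdiff hp,
    (hderiv p hp).fderiv]
  simp only [planeForm_apply]
  constructor <;> field_simp <;> ring

end Coefficients

section Parameters

variable {ε y₀ : ℝ}

theorem sqrt_eps1 (hy₀ : -1 < y₀) : √(eps1 ε y₀) = √ε / (1 + y₀) := by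
  rw [eps1, Real.sqrt_div' _ (sq_nonneg _), Real.sqrt_sq (by linarith)]

theorem sqrt_eps2 (hy₀' : y₀ ≤ 0) : √(eps2 ε y₀) = √ε / (1 - y₀) := by
  rw [eps2, Real.sqrt_div' _ (sq_nonneg _), Real.sqrt_sq (by linarith)]

theorem sqrt_eps2_pos (hε : 0 < ε) (hy₀' : y₀ ≤ 0) : 0 < √(eps2 ε y₀) := by
  rw [sqrt_eps2 hy₀']
  exact div_pos (Real.sqrt_pos.2 hε) (by linarith)

theorem foldRatio_pos (hy₀ : -1 < y₀) (hy₀' : y₀ ≤ 0) : 0 < foldRatio y₀ :=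
  div_pos (by linarith) (by linarith)

theorem foldRatio_le_one (hy₀' : y₀ ≤ 0) : foldRatio y₀ ≤ 1 := by
  rw [foldRatio, div_le_one (by linarith)]
  linarith

theorem sqrt_eps1_eq_div (hy₀ : -1 < y₀) (hy₀' : y₀ ≤ 0) :
    √(eps1 ε y₀) = √(eps2 ε y₀) / foldRatio y₀ := by
  have h1 : 1 + y₀ ≠ 0 := by linarith
  have h2 : 1 - y₀ ≠ 0 := by linarith
  rw [sqrt_eps1 hy₀, sqrt_eps2 hy₀', foldRatio]
  field_simp

theorem lowerPart_eq (hε : 0 < ε) (hy₀ : -1 < y₀) (hy₀' : y₀ ≤ 0) :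
    lowerPart ε y₀ = {p ∈ triangle | p.2 ≤ foldRatio y₀ * p.1} := by
  ext p
  simp only [lowerPart, mem_ofPred_eq, sqrt_eps1_eq_div (ε := ε) hy₀ hy₀']
  rw [div_mul_eq_mul_div, div_le_iff₀ (foldRatio_pos hy₀ hy₀'), mul_assoc,
    mul_le_mul_iff_right₀ (sqrt_eps2_pos hε hy₀'), mul_comm p.1]

theorem upperPart_eq (hε : 0 < ε) (hy₀ : -1 < y₀) (hy₀' : y₀ ≤ 0) :
    upperPart ε y₀ = {p ∈ triangle | foldRatio y₀ * p.1 ≤ p.2} := by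
  ext p
  simp only [upperPart, mem_ofPred_eq, sqrt_eps1_eq_div (ε := ε) hy₀ hy₀']
  rw [div_mul_eq_mul_div, le_div_iff₀ (foldRatio_pos hy₀ hy₀'), mul_assoc,
    mul_le_mul_iff_right₀ (sqrt_eps2_pos hε hy₀'), mul_comm p.1]

theorem exists_regular_extension_of_parts (hε : 0 < ε) (hy₀ : -1 < y₀) (hy₀' : y₀ ≤ 0)
    {k : ℝ × ℝ → ℝ} (hl : ContDiffOn ℝ 1 k (lowerPart ε y₀))
    (hu : ContDiffOn ℝ 1 k (upperPart ε y₀)) :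
    ∃ g, EqOn g k triangle ∧ ∀ m, |m| = 1 → ∃ gy, RegularAlong m g gy := by
  have ha := foldRatio_pos hy₀ hy₀'
  rw [lowerPart_eq hε hy₀ hy₀'] at hl
  rw [upperPart_eq hε hy₀ hy₀'] at hu
  rcases (foldRatio_le_one hy₀').lt_or_eq with h1 | h1
  · have sl : sector 0 (foldRatio y₀) ⊆ {p ∈ triangle | p.2 ≤ foldRatio y₀ * p.1} := by
      rintro p ⟨hx, h2, h3⟩
      exact ⟨⟨by linarith, h3.trans (mul_le_of_le_one_left hx.1 h1.le), hx.2⟩, h3⟩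
    have su : sector (foldRatio y₀) 1 ⊆ {p ∈ triangle | foldRatio y₀ * p.1 ≤ p.2} := by
      rintro p ⟨hx, h2, h3⟩
      exact ⟨⟨(mul_nonneg ha.le hx.1).trans h2, by linarith, hx.2⟩, h2⟩
    obtain ⟨g, hg, hr⟩ := exists_piecewise_regular_extension ha h1 (hl.mono sl) (hu.mono su)
    refine ⟨g, hg, fun m hm => hr m ?_⟩
    rintro rfl
    exact h1.ne ((abs_of_pos ha).symm.trans hm)
  · obtain ⟨g, gy, hg, hr⟩ := exists_regular_extension
      (hl.mono fun p hp => ⟨hp, by rw [h1, one_mul]; exact hp.2.1⟩)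
    exact ⟨g, hg, fun m _ => ⟨gy, hr m⟩⟩

end Parameters

theorem Invariant.forall_iff {P : Invariant → Prop} :
    (∀ i, P i) ↔ P (hat 0) ∧ P (hat 1) ∧ P (check 0) ∧ P (check 1) := by
  refine ⟨fun h => ⟨h _, h _, h _, h _⟩, fun ⟨h0, h1, c0, c1⟩ => ?_⟩
  rintro (j | j) <;> fin_cases j
  exacts [h0, h1, c0, c1]

/-- `d` consists of the normalized coefficients of the second-row kernel system. -/
structure Coefficients.Extends (d : Coefficients) (ε y₀ c₂ : ℝ) (lam₁ lam₂ : ℝ → ℝ)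
    (k₁₁ k₁₂ : ℝ × ℝ → ℝ) : Prop where
  foldRatio_eq : foldRatio y₀ = d.a
  sqrt_eps2 : √(eps2 ε y₀) = d.μ
  eps2_eq : eps2 ε y₀ = d.μ ^ 2
  sqrt_eps1 : √(eps1 ε y₀) = d.μ * d.a⁻¹
  γ_eq : (eps2 ε y₀ - eps1 ε y₀) / (2 * √(eps1 ε y₀)) = d.γ
  eqOn_L₁ : EqOn (d.L 0) (fun y => lam₁ y + c₂) (Icc 0 1)
  eqOn_L₂ : EqOn (d.L 1) (fun y => lam₂ y + c₂) (Icc 0 1)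
  eqOn_k₁ : EqOn (d.k 0) k₁₁ triangle
  eqOn_k₂ : EqOn (d.k 1) k₁₂ triangle

theorem Coefficients.exists_extends {ε y₀ : ℝ} (c₂ : ℝ) {lam₁ lam₂ : ℝ → ℝ} {k₁₁ k₁₂ : ℝ × ℝ → ℝ}
    (hε : 0 < ε) (hy₀ : -1 < y₀) (hy₀' : y₀ ≤ 0)
    (hlam₁ : ContDiffOn ℝ 1 lam₁ (Icc 0 1)) (hlam₂ : ContDiffOn ℝ 1 lam₂ (Icc 0 1))
    (hk₁₁ : ContDiffOn ℝ 1 k₁₁ triangle) (hk₁₂_lower : ContDiffOn ℝ 1 k₁₂ (lowerPart ε y₀))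
    (hk₁₂_upper : ContDiffOn ℝ 1 k₁₂ (upperPart ε y₀)) :
    ∃ d : Coefficients, d.Extends ε y₀ c₂ lam₁ lam₂ k₁₁ k₁₂ ∧ d.IsRegular := by
  obtain ⟨l₁, hl₁, el₁⟩ := exists_contDiff_extension hlam₁
  obtain ⟨l₂, hl₂, el₂⟩ := exists_contDiff_extension hlam₂
  obtain ⟨g₁, g₁y, eg₁, hg₁⟩ := exists_regular_extension hk₁₁
  obtain ⟨g₂, eg₂, hg₂⟩ := exists_regular_extension_of_parts hε hy₀ hy₀' hk₁₂_lower hk₁₂_upper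
  have hμ := sqrt_eps2_pos hε hy₀'
  have hL : ∀ j : Fin 2, ContDiff ℝ 1 ((![fun y => l₁ y + c₂, fun y => l₂ y + c₂] : _ → ℝ → ℝ) j) :=
    Fin.forall_fin_two.2 ⟨hl₁.add contDiff_const, hl₂.add contDiff_const⟩
  let d : Coefficients :=
    { a := foldRatio y₀
      μ := √(eps2 ε y₀)
      γ := (eps2 ε y₀ - eps1 ε y₀) / (2 * √(eps1 ε y₀))
      L := ![fun y => l₁ y + c₂, fun y => l₂ y + c₂]
      k := ![g₁, g₂]
      a_pos := foldRatio_pos hy₀ hy₀'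
      a_le_one := foldRatio_le_one hy₀'
      μ_pos := hμ
      continuous_L := fun j => (hL j).continuous
      continuous_k := Fin.forall_fin_two.2 ⟨(hg₁ 0).cont, (hg₂ 1 abs_one).elim fun _ h => h.cont⟩ }
  refine ⟨d, ⟨rfl, rfl, (Real.sq_sqrt (Real.sqrt_pos.1 hμ).le).symm, sqrt_eps1_eq_div hy₀ hy₀', rfl,
    fun y hy => congrArg (· + c₂) (el₁ hy), fun y hy => congrArg (· + c₂) (el₂ hy), eg₁, eg₂⟩,
    hL, Invariant.forall_iff.2 ⟨⟨g₁y, hg₁ _⟩, hg₂ 1 abs_one, ⟨g₁y, hg₁ _⟩, hg₂ (-1) (by simp)⟩⟩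

namespace Coefficients.Extends

variable {d : Coefficients} {ε y₀ c₂ : ℝ} {lam₁ lam₂ : ℝ → ℝ} {k₁₁ k₁₂ : ℝ × ℝ → ℝ}
  {v : Invariant → ℝ × ℝ → ℝ} {p : ℝ × ℝ}

theorem k21Of_eq (h : d.Extends ε y₀ c₂ lam₁ lam₂ k₁₁ k₁₂) :
    k21Of ε y₀ (v (hat 0)) (v (check 0)) = d.kernel v 0 := by
  funext p
  simp [k21Of, kernel, recover, diagonalRate, h.sqrt_eps2]

theorem eqOn_k22Of (h : d.Extends ε y₀ c₂ lam₁ lam₂ k₁₁ k₁₂) :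
    EqOn (k22Of ε y₀ c₂ lam₂ (v (hat 1)) (v (check 1))) (d.kernel v 1) triangle := by
  intro p hp
  rw [k22Of, kernel, recover, h.sqrt_eps2, h.eps2_eq, ← intervalIntegral.integral_neg]
  congr 1
  refine intervalIntegral.integral_congr fun z hz => ?_
  rw [uIcc_of_le hp.1] at hz
  exact congrArg (fun l => -(l / (2 * d.μ ^ 2)))
    (h.eqOn_L₂ ⟨hz.1, hz.2.trans (hp.2.1.trans hp.2.2)⟩).symm

theorem source_zero_eq (h : d.Extends ε y₀ c₂ lam₁ lam₂ k₁₁ k₁₂) (hp : p ∈ triangle) :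
    (lam₁ p.2 + c₂) * k21Of ε y₀ (v (hat 0)) (v (check 0)) p
      - gTrace ε y₀ (v (hat 0)) (v (check 0)) p.1 * k₁₁ p = d.source v 0 p := by
  rw [source, gTrace, h.γ_eq, h.k21Of_eq, h.eqOn_L₁ (snd_mem_of_mem_triangle hp), h.eqOn_k₁ hp]

theorem source_one_eq (h : d.Extends ε y₀ c₂ lam₁ lam₂ k₁₁ k₁₂) (hp : p ∈ triangle) :
    (lam₂ p.2 + c₂) * k22Of ε y₀ c₂ lam₂ (v (hat 1)) (v (check 1)) p
      - gTrace ε y₀ (v (hat 0)) (v (check 0)) p.1 * k₁₂ p = d.source v 1 p := by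
  rw [source, gTrace, h.γ_eq, h.eqOn_k22Of hp, h.eqOn_L₂ (snd_mem_of_mem_triangle hp), h.eqOn_k₂ hp]

theorem r_eq (h : d.Extends ε y₀ c₂ lam₁ lam₂ k₁₁ k₁₂) :
    (√(eps1 ε y₀) - √(eps2 ε y₀)) / (√(eps1 ε y₀) + √(eps2 ε y₀)) = d.r := by
  have ha := d.a_pos
  have hμ := d.μ_pos
  rw [h.sqrt_eps1, h.sqrt_eps2, r]
  field_simp

theorem flux_eq (h : d.Extends ε y₀ c₂ lam₁ lam₂ k₁₁ k₁₂) (f : ℝ × ℝ → ℝ) (p : ℝ × ℝ) :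
    d.μ * (dx f p + d.slope (hat 0) * dy f p) = √(eps2 ε y₀) * dx f p + √(eps1 ε y₀) * dy f p ∧
    d.μ * (dx f p + d.slope (hat 1) * dy f p) = √(eps2 ε y₀) * dx f p + √(eps2 ε y₀) * dy f p ∧
    d.μ * (dx f p + d.slope (check 0) * dy f p) = √(eps2 ε y₀) * dx f p - √(eps1 ε y₀) * dy f p ∧
    d.μ * (dx f p + d.slope (check 1) * dy f p) =
      √(eps2 ε y₀) * dx f p - √(eps2 ε y₀) * dy f p := by
  simp only [h.sqrt_eps1, h.sqrt_eps2, slope, speed, Matrix.cons_val_zero, Matrix.cons_val_one]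
  refine ⟨?_, ?_, ?_, ?_⟩ <;> ring

theorem isSecondRowSolution_iff (h : d.Extends ε y₀ c₂ lam₁ lam₂ k₁₁ k₁₂) :
    IsSecondRowSolution ε y₀ c₂ lam₁ lam₂ k₁₁ k₁₂ (v (hat 0)) (v (hat 1)) (v (check 0))
      (v (check 1)) ↔ d.IsClassical v := by
  have flux := fun i p => h.flux_eq (v i) p
  constructor
  · intro hv
    refine ⟨forall_iff.2 ⟨hv.1, hv.2, hv.3, hv.4⟩, forall_iff.2 ⟨fun p hp => ?_, fun p hp => ?_,
      fun p hp => ?_, fun p hp => ?_⟩, forall_iff.2 ⟨fun x hx => ?_, fun x hx => ?_,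
      fun x hx => ?_, fun x hx => ?_⟩⟩
    · exact (flux _ p).1.trans ((hv.pde_kh₂₁ p hp).trans (h.source_zero_eq hp))
    · exact (flux _ p).2.1.trans ((hv.pde_kh₂₂ p hp).trans (h.source_one_eq hp))
    · exact (flux _ p).2.2.1.trans ((hv.pde_kc₂₁ p hp).trans (h.source_zero_eq hp))
    · exact (flux _ p).2.2.2.trans ((hv.pde_kc₂₂ p hp).trans (h.source_one_eq hp))
    · simpa [base, trace, q, t₁, h.foldRatio_eq] using hv.bc_kh₂₁ x hx
    · simpa [base, trace, q, t₂, h.foldRatio_eq] using hv.bc_kh₂₂ x hx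
    · simpa [base, trace, h.r_eq] using hv.bc_kc₂₁ x hx
    · simpa [base, trace, h.eqOn_L₂ hx, h.sqrt_eps2] using hv.bc_kc₂₂ x hx
  · intro hv
    refine ⟨hv.1 _, hv.1 _, hv.1 _, hv.1 _, fun p hp => ?_, fun p hp => ?_, fun p hp => ?_,
      fun p hp => ?_, fun x hx => ?_, fun x hx => ?_, fun x hx => ?_, fun x hx => ?_⟩
    · exact (flux _ p).1.symm.trans ((hv.pde _ p hp).trans (h.source_zero_eq hp).symm)
    · exact (flux _ p).2.1.symm.trans ((hv.pde _ p hp).trans (h.source_one_eq hp).symm)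
    · exact (flux _ p).2.2.1.symm.trans ((hv.pde _ p hp).trans (h.source_zero_eq hp).symm)
    · exact (flux _ p).2.2.2.symm.trans ((hv.pde _ p hp).trans (h.source_one_eq hp).symm)
    · simpa [base, trace, q, t₁, h.foldRatio_eq] using hv.boundary (hat 0) x hx
    · simpa [base, trace, q, t₂, h.foldRatio_eq] using hv.boundary (hat 1) x hx
    · simpa [base, trace, h.r_eq] using hv.boundary (check 0) x hx
    · simpa [base, trace, h.eqOn_L₂ hx, h.sqrt_eps2] using hv.boundary (check 1) x hx

end Coefficients.Extends

/-- The family of invariants with the given members. -/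
def invariants (kh₁ kh₂ kc₁ kc₂ : ℝ × ℝ → ℝ) : Invariant → ℝ × ℝ → ℝ
  | hat j => ![kh₁, kh₂] j
  | check j => ![kc₁, kc₂] j

theorem Coefficients.Extends.eqOn_of_isSecondRowSolution {d : Coefficients} {ε y₀ c₂ : ℝ}
    {lam₁ lam₂ : ℝ → ℝ} {k₁₁ k₁₂ : ℝ × ℝ → ℝ} {u : Invariant → ℝ × ℝ → ℝ}
    (h : d.Extends ε y₀ c₂ lam₁ lam₂ k₁₁ k₁₂) (hu : d.IsClassical u)
    {lh₁ lh₂ lc₁ lc₂ : ℝ × ℝ → ℝ}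
    (hl : IsSecondRowSolution ε y₀ c₂ lam₁ lam₂ k₁₁ k₁₂ lh₁ lh₂ lc₁ lc₂) :
    EqOn lh₁ (u (hat 0)) triangle ∧ EqOn lh₂ (u (hat 1)) triangle ∧
      EqOn lc₁ (u (check 0)) triangle ∧ EqOn lc₂ (u (check 1)) triangle :=
  forall_iff.1 ((h.isSecondRowSolution_iff (v := invariants lh₁ lh₂ lc₁ lc₂)).1 hl |>.eqOn hu)

end FoldedKernel

end

theorem lemma5_general (ε y₀ c₂ : ℝ) (hε : 0 < ε) (hy₀ : -1 < y₀) (hy₀' : y₀ ≤ 0)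
    (lam₁ lam₂ : ℝ → ℝ) (hlam₁ : ContDiffOn ℝ 1 lam₁ (Icc 0 1))
    (hlam₂ : ContDiffOn ℝ 1 lam₂ (Icc 0 1))
    (k₁₁ k₁₂ : ℝ × ℝ → ℝ)
    (hk₁₁ : ContDiffOn ℝ 1 k₁₁ FoldedKernel.triangle)
    (hk₁₂_lower : ContDiffOn ℝ 1 k₁₂ (FoldedKernel.lowerPart ε y₀))
    (hk₁₂_upper : ContDiffOn ℝ 1 k₁₂ (FoldedKernel.upperPart ε y₀)) :
    ∃ kh₂₁ kh₂₂ kc₂₁ kc₂₂ : ℝ × ℝ → ℝ,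
      FoldedKernel.IsSecondRowSolution ε y₀ c₂ lam₁ lam₂ k₁₁ k₁₂ kh₂₁ kh₂₂ kc₂₁ kc₂₂ ∧
      (∀ lh₂₁ lh₂₂ lc₂₁ lc₂₂ : ℝ × ℝ → ℝ,
        FoldedKernel.IsSecondRowSolution ε y₀ c₂ lam₁ lam₂ k₁₁ k₁₂ lh₂₁ lh₂₂ lc₂₁ lc₂₂ →
          EqOn lh₂₁ kh₂₁ FoldedKernel.triangle ∧ EqOn lh₂₂ kh₂₂ FoldedKernel.triangle ∧
          EqOn lc₂₁ kc₂₁ FoldedKernel.triangle ∧ EqOn lc₂₂ kc₂₂ FoldedKernel.triangle) ∧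
      ContDiffOn ℝ 2 (FoldedKernel.k21Of ε y₀ kh₂₁ kc₂₁) FoldedKernel.triangle ∧
      ContDiffOn ℝ 2 (FoldedKernel.k22Of ε y₀ c₂ lam₂ kh₂₂ kc₂₂) FoldedKernel.triangle ∧
      (∀ p ∈ FoldedKernel.triangle,
        kh₂₁ p = √(FoldedKernel.eps2 ε y₀) *
            FoldedKernel.dx (FoldedKernel.k21Of ε y₀ kh₂₁ kc₂₁) p
          - √(FoldedKernel.eps1 ε y₀) *
            FoldedKernel.dy (FoldedKernel.k21Of ε y₀ kh₂₁ kc₂₁) p ∧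
        kc₂₁ p = √(FoldedKernel.eps2 ε y₀) *
            FoldedKernel.dx (FoldedKernel.k21Of ε y₀ kh₂₁ kc₂₁) p
          + √(FoldedKernel.eps1 ε y₀) *
            FoldedKernel.dy (FoldedKernel.k21Of ε y₀ kh₂₁ kc₂₁) p ∧
        kh₂₂ p = √(FoldedKernel.eps2 ε y₀) *
            FoldedKernel.dx (FoldedKernel.k22Of ε y₀ c₂ lam₂ kh₂₂ kc₂₂) p
          - √(FoldedKernel.eps2 ε y₀) *
            FoldedKernel.dy (FoldedKernel.k22Of ε y₀ c₂ lam₂ kh₂₂ kc₂₂) p ∧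
        kc₂₂ p = √(FoldedKernel.eps2 ε y₀) *
            FoldedKernel.dx (FoldedKernel.k22Of ε y₀ c₂ lam₂ kh₂₂ kc₂₂) p
          + √(FoldedKernel.eps2 ε y₀) *
            FoldedKernel.dy (FoldedKernel.k22Of ε y₀ c₂ lam₂ kh₂₂ kc₂₂) p) := by
  obtain ⟨d, hext, hreg⟩ := FoldedKernel.Coefficients.exists_extends c₂ hε hy₀ hy₀' hlam₁ hlam₂
    hk₁₁ hk₁₂_lower hk₁₂_upper
  obtain ⟨u, hu⟩ := d.exists_isMild
  have hclass := hu.isClassical hreg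
  have hk₂₁ := hext.k21Of_eq (v := u)
  have hk₂₂ := hext.eqOn_k22Of (v := u)
  refine ⟨u (.hat 0), u (.hat 1), u (.check 0), u (.check 1),
    hext.isSecondRowSolution_iff.2 hclass, fun _ _ _ _ => hext.eqOn_of_isSecondRowSolution hclass,
    hk₂₁ ▸ hu.contDiffOn_kernel hreg 0, (hu.contDiffOn_kernel hreg 1).congr hk₂₂, fun p hp => ?_⟩
  have h₁ := hu.eq_dx_kernel hreg 0 hp
  have h₂ := hu.eq_dx_kernel hreg 1 hp
  rw [FoldedKernel.dx_congr hk₂₂ hp, FoldedKernel.dy_congr hk₂₂ hp, hk₂₁, hext.sqrt_eps1,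
    hext.sqrt_eps2]
  rw [show d.speed 1 = 1 from rfl, mul_one] at h₂
  exact ⟨h₁.1, h₁.2, h₂⟩

theorem lemma5 (ε y₀ c₂ : ℝ) (hε : 0 < ε) (hy₀ : -1 < y₀) (hy₀' : y₀ ≤ 0) (hc₂ : 0 < c₂)
    (lam₁ lam₂ : ℝ → ℝ) (hlam₁ : ContDiffOn ℝ 1 lam₁ (Icc 0 1))
    (hlam₂ : ContDiffOn ℝ 1 lam₂ (Icc 0 1))
    (k₁₁ k₁₂ : ℝ × ℝ → ℝ)
    (hk₁₁ : ContDiffOn ℝ 1 k₁₁ FoldedKernel.triangle)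
    (hk₁₂ : ContinuousOn k₁₂ FoldedKernel.triangle)
    (hk₁₂_lower : ContDiffOn ℝ 1 k₁₂ (FoldedKernel.lowerPart ε y₀))
    (hk₁₂_upper : ContDiffOn ℝ 1 k₁₂ (FoldedKernel.upperPart ε y₀)) :
    ∃ kh₂₁ kh₂₂ kc₂₁ kc₂₂ : ℝ × ℝ → ℝ,
      FoldedKernel.IsSecondRowSolution ε y₀ c₂ lam₁ lam₂ k₁₁ k₁₂ kh₂₁ kh₂₂ kc₂₁ kc₂₂ ∧
      (∀ lh₂₁ lh₂₂ lc₂₁ lc₂₂ : ℝ × ℝ → ℝ,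
        FoldedKernel.IsSecondRowSolution ε y₀ c₂ lam₁ lam₂ k₁₁ k₁₂ lh₂₁ lh₂₂ lc₂₁ lc₂₂ →
          EqOn lh₂₁ kh₂₁ FoldedKernel.triangle ∧ EqOn lh₂₂ kh₂₂ FoldedKernel.triangle ∧
          EqOn lc₂₁ kc₂₁ FoldedKernel.triangle ∧ EqOn lc₂₂ kc₂₂ FoldedKernel.triangle) ∧
      ContDiffOn ℝ 2 (FoldedKernel.k21Of ε y₀ kh₂₁ kc₂₁) FoldedKernel.triangle ∧
      ContDiffOn ℝ 2 (FoldedKernel.k22Of ε y₀ c₂ lam₂ kh₂₂ kc₂₂) FoldedKernel.triangle ∧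
      (∀ p ∈ FoldedKernel.triangle,
        kh₂₁ p = √(FoldedKernel.eps2 ε y₀) *
            FoldedKernel.dx (FoldedKernel.k21Of ε y₀ kh₂₁ kc₂₁) p
          - √(FoldedKernel.eps1 ε y₀) *
            FoldedKernel.dy (FoldedKernel.k21Of ε y₀ kh₂₁ kc₂₁) p ∧
        kc₂₁ p = √(FoldedKernel.eps2 ε y₀) *
            FoldedKernel.dx (FoldedKernel.k21Of ε y₀ kh₂₁ kc₂₁) p
          + √(FoldedKernel.eps1 ε y₀) *
            FoldedKernel.dy (FoldedKernel.k21Of ε y₀ kh₂₁ kc₂₁) p ∧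
        kh₂₂ p = √(FoldedKernel.eps2 ε y₀) *
            FoldedKernel.dx (FoldedKernel.k22Of ε y₀ c₂ lam₂ kh₂₂ kc₂₂) p
          - √(FoldedKernel.eps2 ε y₀) *
            FoldedKernel.dy (FoldedKernel.k22Of ε y₀ c₂ lam₂ kh₂₂ kc₂₂) p ∧
        kc₂₂ p = √(FoldedKernel.eps2 ε y₀) *
            FoldedKernel.dx (FoldedKernel.k22Of ε y₀ c₂ lam₂ kh₂₂ kc₂₂) p
          + √(FoldedKernel.eps2 ε y₀) *
            FoldedKernel.dy (FoldedKernel.k22Of ε y₀ c₂ lam₂ kh₂₂ kc₂₂) p) := by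
  exact lemma5_general ε y₀ c₂ hε hy₀ hy₀' lam₁ lam₂ hlam₁ hlam₂ k₁₁ k₁₂ hk₁₁ hk₁₂_lower hk₁₂_upper
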